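/- Let $A$ be an associative unital ring (for instance an algebra over a commutative ring $k$), let $\mathcal C$ be an $A$-coring, i.e. a comonoid in the category of $A$-$A$ bimodules, with coproduct $c\mapsto c^{(1)}\otimes_A c^{(2)}$ and counit $\epsilon$, and suppose that $\mathcal C$ is finitely generated and projective as a left $A$-module. Let $\Sigma$ be a right $\mathcal C$-comodule with coaction $x\mapsto x^{[0]}\otimes_A x^{[1]}$, and let $T=\mathrm{End}^{\mathcal C}(\Sigma)$ be its ring of comodule endomorphisms, acting on $\Sigma$ from the left. Let ${}^*\mathcal C={}_A\mathrm{Hom}(\mathcal C,A)$ be the ring with multiplication $(ff')(c)=f'(c^{(1)}f(c^{(2)}))$ and unit $\epsilon$, which is a right $A$-module by $(fa)(c)=f(c)a$; it acts on every right $\mathcal C$-comodule from the right by $xf=x^{[0]}f(x^{[1]})$. Let $$Q=\{\,q\in\mathrm{Hom}_A(\Sigma,{}^*\mathcal C)\ :\ q(x^{[0]})(c)\,x^{[1]}=c^{(1)}q(x)(c^{(2)})\ \text{ for all } x\in\Sigma,\ c\in\mathcal C\,\},$$ a ${}^*\mathcal C$-$T$ bimodule by $(fq)(x)=f\,q(x)$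 and $(qt)(x)=q(t(x))$, and let $\mathbb M(\Sigma)=(T,{}^*\mathcal C,\Sigma,Q)$ be the Morita context with connecting maps $$Q\otimes_T\Sigma\to{}^*\mathcal C,\quad q\otimes x\mapsto q(x),\qquad\qquad \Sigma\otimes_{{}^*\mathcal C}Q\to T,\quad x\otimes q\mapsto\big(y\mapsto x\,q(y)\big).$$ Then the following are equivalent. 1. The Morita context $\mathbb M(\Sigma)$ is strict, i.e. both connecting maps are isomorphisms. 2. $\Sigma$ is a Galois comodule, i.e. for every right $A$-module $N$ the map $\mathrm{Hom}_A(\Sigma,N)\otimes_T\Sigma\to N\otimes_A\mathcal C$, $\varphi\otimes x\mapsto\varphi(x^{[0]})\otimes x^{[1]}$, is bijective; moreover $\Sigma$ is finitely generated and projective as a right $A$-module and faithfully flat as a left $T$-module. 3. The functor $-\otimes_T\Sigma:\mathcal M_T\to\mathcal M^{\mathcal C}$ from right $T$-modules to right $\mathcal C$-comodules is an equivalence of categories with inverse $\mathrm{Hom}^{\mathcal C}(\Sigma,-)$. -/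

import Mathlib

open MulOpposite

universe u

namespace CoringMorita

/-! Right modules over a ring `R` are modules over `Rᵐᵒᵖ`; the product `m · r` is `op r • m`.
An `R`-`S` bimodule carries `Module R`, `Module Sᵐᵒᵖ` and `SMulCommClass R Sᵐᵒᵖ`. -/

/-! ### The tensor product over a noncommutative ring -/

section Tensor

open scoped TensorProduct

/-- The subgroup of `M ⊗[ℤ] N` generated by all `m · r ⊗ n - m ⊗ r · n`. -/
def balRel (R M N : Type*) [Ring R] [AddCommGroup M] [Module Rᵐᵒᵖ M] [AddCommGroup N]
    [Module R N] : AddSubgroup (M ⊗[ℤ] N) :=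
  AddSubgroup.closure {z | ∃ (m : M) (r : R) (n : N), z = (op r • m) ⊗ₜ[ℤ] n - m ⊗ₜ[ℤ] (r • n)}

/-- The tensor product `M ⊗_R N` of a right `R`-module `M` and a left `R`-module `N`. -/
def BalTensor (R M N : Type*) [Ring R] [AddCommGroup M] [Module Rᵐᵒᵖ M] [AddCommGroup N]
    [Module R N] : Type _ :=
  (M ⊗[ℤ] N) ⧸ balRel R M N

namespace BalTensor

variable {R M N M' N' M'' N'' P : Type*} [Ring R]
  [AddCommGroup M] [Module Rᵐᵒᵖ M] [AddCommGroup N] [Module R N]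
  [AddCommGroup M'] [Module Rᵐᵒᵖ M'] [AddCommGroup N'] [Module R N']
  [AddCommGroup M''] [Module Rᵐᵒᵖ M''] [AddCommGroup N''] [Module R N'']
  [AddCommGroup P]

instance : AddCommGroup (BalTensor R M N) :=
  inferInstanceAs (AddCommGroup ((M ⊗[ℤ] N) ⧸ balRel R M N))

/-- The pure tensor `m ⊗_R n`. -/
def tmul (R : Type*) {M N : Type*} [Ring R] [AddCommGroup M] [Module Rᵐᵒᵖ M] [AddCommGroup N]
    [Module R N] (m : M) (n : N) : BalTensor R M N :=
  QuotientAddGroup.mk' (balRel R M N) (m ⊗ₜ[ℤ] n)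

theorem add_tmul (m m' : M) (n : N) : tmul R (m + m') n = tmul R m n + tmul R m' n := by
  simp only [tmul, TensorProduct.add_tmul]; exact map_add _ _ _

theorem tmul_add (m : M) (n n' : N) : tmul R m (n + n') = tmul R m n + tmul R m n' := by
  simp only [tmul, TensorProduct.tmul_add]; exact map_add _ _ _

theorem zero_tmul (n : N) : tmul R (0 : M) n = 0 := by
  simp only [tmul, TensorProduct.zero_tmul]; exact map_zero _

theorem tmul_zero (m : M) : tmul R m (0 : N) = 0 := by
  simp only [tmul, TensorProduct.tmul_zero]; exact map_zero _

theorem smul_tmul (m : M) (r : R) (n : N) : tmul R (op r • m) n = tmul R m (r • n) := by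
  refine (QuotientAddGroup.eq_iff_sub_mem).2 ?_
  exact AddSubgroup.subset_closure ⟨m, r, n, rfl⟩

theorem induction {motive : BalTensor R M N → Prop} (z : BalTensor R M N) (zero : motive 0)
    (tmul : ∀ m n, motive (tmul R m n)) (add : ∀ x y, motive x → motive y → motive (x + y)) :
    motive z := by
  obtain ⟨t, rfl⟩ := QuotientAddGroup.mk'_surjective (balRel R M N) z
  induction t using TensorProduct.induction_on with
  | zero => exact (map_zero (QuotientAddGroup.mk' (balRel R M N))).symm ▸ zero
  | tmul m n => exact tmul m n
  | add x y hx hy => exact (map_add (QuotientAddGroup.mk' (balRel R M N)) x y).symm ▸ add _ _ hx hy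

/-- The universal property: a biadditive `R`-balanced map factors through `M ⊗_R N`. -/
def lift (f : M →+ N →+ P) (hf : ∀ m (r : R) n, f (op r • m) n = f m (r • n)) :
    BalTensor R M N →+ P :=
  QuotientAddGroup.lift (balRel R M N)
    (TensorProduct.liftAddHom f fun z m n => by simp) (by
      refine (AddSubgroup.closure_le _).2 ?_
      rintro _ ⟨m, r, n, rfl⟩
      simp [hf])

@[simp] theorem lift_tmul (f : M →+ N →+ P) (hf : ∀ m (r : R) n, f (op r • m) n = f m (r • n))
    (m : M) (n : N) : lift f hf (tmul R m n) = f m n :=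
  rfl

theorem hom_ext {f g : BalTensor R M N →+ P} (h : ∀ m n, f (tmul R m n) = g (tmul R m n)) :
    f = g := by
  ext z
  induction z using induction with
  | zero => simp
  | tmul m n => exact h m n
  | add x y hx hy => simp [hx, hy]

theorem hom_ext_apply {f g : BalTensor R M N →+ P}
    (h : ∀ m n, f (tmul R m n) = g (tmul R m n)) (z : BalTensor R M N) : f z = g z := by
  rw [hom_ext h]

/-- Build a homomorphism out of `M ⊗_R N` from an unbundled biadditive balanced map. -/
def lift' (f : M → N → P) (h₁ : ∀ m m' n, f (m + m') n = f m n + f m' n)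
    (h₂ : ∀ m n n', f m (n + n') = f m n + f m n')
    (h₃ : ∀ m (r : R) n, f (op r • m) n = f m (r • n)) : BalTensor R M N →+ P :=
  lift (AddMonoidHom.mk' (fun m => AddMonoidHom.mk' (f m) (h₂ m))
    fun m m' => by ext n; exact h₁ m m' n) h₃

@[simp] theorem lift'_tmul (f : M → N → P) (h₁ : ∀ m m' n, f (m + m') n = f m n + f m' n)
    (h₂ : ∀ m n n', f m (n + n') = f m n + f m n')
    (h₃ : ∀ m (r : R) n, f (op r • m) n = f m (r • n)) (m : M) (n : N) :
    lift' f h₁ h₂ h₃ (tmul R m n) = f m n :=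
  rfl

/-- The map `f ⊗_R g`. -/
def map (f : M →ₗ[Rᵐᵒᵖ] M') (g : N →ₗ[R] N') : BalTensor R M N →+ BalTensor R M' N' :=
  lift' (fun m n => tmul R (f m) (g n)) (fun m m' n => by rw [map_add, add_tmul])
    (fun m n n' => by rw [map_add, tmul_add])
    (fun m r n => by rw [map_smul, map_smul, smul_tmul])

@[simp] theorem map_tmul (f : M →ₗ[Rᵐᵒᵖ] M') (g : N →ₗ[R] N') (m : M) (n : N) :
    map f g (tmul R m n) = tmul R (f m) (g n) :=
  rfl

theorem map_id (z : BalTensor R M N) :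
    map (LinearMap.id : M →ₗ[Rᵐᵒᵖ] M) (LinearMap.id : N →ₗ[R] N) z = z :=
  hom_ext_apply (f := map LinearMap.id LinearMap.id) (g := AddMonoidHom.id _) (fun _ _ => rfl) z

theorem map_comp (f' : M' →ₗ[Rᵐᵒᵖ] M'') (g' : N' →ₗ[R] N'') (f : M →ₗ[Rᵐᵒᵖ] M')
    (g : N →ₗ[R] N') (z : BalTensor R M N) :
    map (f' ∘ₗ f) (g' ∘ₗ g) z = map f' g' (map f g z) :=
  hom_ext_apply (f := map (f' ∘ₗ f) (g' ∘ₗ g)) (g := (map f' g').comp (map f g))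
    (fun _ _ => rfl) z

theorem map_add_left (f f' : M →ₗ[Rᵐᵒᵖ] M') (g : N →ₗ[R] N') (z : BalTensor R M N) :
    map (f + f') g z = map f g z + map f' g z :=
  hom_ext_apply (g := map f g + map f' g) (fun _ _ => add_tmul _ _ _) z

theorem map_zero_left (g : N →ₗ[R] N') (z : BalTensor R M N) :
    map (0 : M →ₗ[Rᵐᵒᵖ] M') g z = 0 :=
  hom_ext_apply (g := 0) (fun _ _ => zero_tmul _) z

theorem map_add_right (f : M →ₗ[Rᵐᵒᵖ] M') (g g' : N →ₗ[R] N') (z : BalTensor R M N) :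
    map f (g + g') z = map f g z + map f g' z :=
  hom_ext_apply (g := map f g + map f g') (fun _ _ => tmul_add _ _ _) z

theorem map_zero_right (f : M →ₗ[Rᵐᵒᵖ] M') (z : BalTensor R M N) :
    map f (0 : N →ₗ[R] N') z = 0 :=
  hom_ext_apply (g := 0) (fun _ _ => tmul_zero _) z

section Actions

variable {S S' : Type*} [Ring S] [Ring S']

/-- Left multiplication by `s` on an `S`-`R` bimodule, as a right `R`-linear map. -/
def lmul (R : Type*) {M S : Type*} [Ring R] [Ring S] [AddCommGroup M] [Module Rᵐᵒᵖ M] [Module S M]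
    [SMulCommClass S Rᵐᵒᵖ M] (s : S) : M →ₗ[Rᵐᵒᵖ] M where
  toFun m := s • m
  map_add' := smul_add s
  map_smul' r m := smul_comm s r m

/-- Right multiplication by `s` on an `R`-`S` bimodule, as a left `R`-linear map. -/
def rmul (R : Type*) {N S : Type*} [Ring R] [Ring S] [AddCommGroup N] [Module R N] [Module Sᵐᵒᵖ N]
    [SMulCommClass R Sᵐᵒᵖ N] (s : Sᵐᵒᵖ) : N →ₗ[R] N where
  toFun n := s • n
  map_add' := smul_add s
  map_smul' r n := (smul_comm r s n).symm

/-- The left action `s · (m ⊗ n) = s · m ⊗ n` for an `S`-`R` bimodule `M`. -/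
instance (priority := 100) leftModule [Module S M] [SMulCommClass S Rᵐᵒᵖ M] :
    Module S (BalTensor R M N) where
  smul s z := map (lmul R s) LinearMap.id z
  one_smul z := by
    refine Eq.trans ?_ (map_id z)
    change map _ _ z = _
    congr 2; ext m; exact one_smul S m
  mul_smul s t z := by
    change map _ _ z = map _ _ (map _ _ z)
    rw [← map_comp]
    congr 2; ext m; exact mul_smul s t m
  smul_zero s := map_zero _
  smul_add s := map_add _
  add_smul s t z := by
    change map _ _ z = map _ _ z + map _ _ z
    rw [← map_add_left]
    congr 2; ext m; exact add_smul s t m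
  zero_smul z := by
    refine Eq.trans ?_ (map_zero_left LinearMap.id z)
    change map _ _ z = _
    congr 2; ext m; exact zero_smul S m

/-- The right action `(m ⊗ n) · s = m ⊗ n · s` for an `R`-`S` bimodule `N`. -/
instance rightModule [Module Sᵐᵒᵖ N] [SMulCommClass R Sᵐᵒᵖ N] :
    Module Sᵐᵒᵖ (BalTensor R M N) where
  smul s z := map LinearMap.id (rmul R s) z
  one_smul z := by
    refine Eq.trans ?_ (map_id z)
    change map _ _ z = _
    congr 2; ext m; exact one_smul Sᵐᵒᵖ m
  mul_smul s t z := by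
    change map _ _ z = map _ _ (map _ _ z)
    rw [← map_comp]
    congr 2; ext m; exact mul_smul s t m
  smul_zero s := map_zero _
  smul_add s := map_add _
  add_smul s t z := by
    change map _ _ z = map _ _ z + map _ _ z
    rw [← map_add_right]
    congr 2; ext m; exact add_smul s t m
  zero_smul z := by
    refine Eq.trans ?_ (map_zero_right LinearMap.id z)
    change map _ _ z = _
    congr 2; ext m; exact zero_smul Sᵐᵒᵖ m

@[simp] theorem left_smul_tmul [Module S M] [SMulCommClass S Rᵐᵒᵖ M] (s : S) (m : M) (n : N) :
    s • tmul R m n = tmul R (s • m) n :=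
  rfl

@[simp] theorem right_smul_tmul [Module Sᵐᵒᵖ N] [SMulCommClass R Sᵐᵒᵖ N] (s : Sᵐᵒᵖ) (m : M)
    (n : N) : s • tmul R m n = tmul R m (s • n) :=
  rfl

instance [Module S M] [SMulCommClass S Rᵐᵒᵖ M] [Module S'ᵐᵒᵖ N] [SMulCommClass R S'ᵐᵒᵖ N] :
    SMulCommClass S S'ᵐᵒᵖ (BalTensor R M N) where
  smul_comm s s' z := by
    change map _ _ (map _ _ z) = map _ _ (map _ _ z)
    rw [← map_comp, ← map_comp]
    rfl

/-- An additive map that commutes with the left action on pure tensors is left linear. -/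
theorem map_left_smul [Module S M] [SMulCommClass S Rᵐᵒᵖ M] [Module S P]
    (f : BalTensor R M N →+ P) (h : ∀ (s : S) m n, f (tmul R (s • m) n) = s • f (tmul R m n))
    (s : S) (z : BalTensor R M N) : f (s • z) = s • f z := by
  induction z using induction with
  | zero => simp
  | tmul m n => exact h s m n
  | add x y hx hy => simp [smul_add, hx, hy]

/-- An additive map that commutes with the right action on pure tensors is right linear. -/
theorem map_right_smul [Module Sᵐᵒᵖ N] [SMulCommClass R Sᵐᵒᵖ N] [Module Sᵐᵒᵖ P]
    (f : BalTensor R M N →+ P)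
    (h : ∀ (s : Sᵐᵒᵖ) m n, f (tmul R m (s • n)) = s • f (tmul R m n))
    (s : Sᵐᵒᵖ) (z : BalTensor R M N) : f (s • z) = s • f z := by
  induction z using induction with
  | zero => simp
  | tmul m n => exact h s m n
  | add x y hx hy => simp [smul_add, hx, hy]

/-- `f ⊗_R N` for a right `R`-linear map `f`, as a right `S`-linear map. -/
def rTensor (N : Type*) [AddCommGroup N] [Module R N] [Module Sᵐᵒᵖ N] [SMulCommClass R Sᵐᵒᵖ N]
    (f : M →ₗ[Rᵐᵒᵖ] M') : BalTensor R M N →ₗ[Sᵐᵒᵖ] BalTensor R M' N where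
  toFun := map f LinearMap.id
  map_add' := map_add _
  map_smul' := map_right_smul (map f LinearMap.id) fun _ _ _ => rfl

@[simp] theorem rTensor_tmul [Module Sᵐᵒᵖ N] [SMulCommClass R Sᵐᵒᵖ N] (f : M →ₗ[Rᵐᵒᵖ] M')
    (m : M) (n : N) : rTensor (S := S) N f (tmul R m n) = tmul R (f m) n :=
  rfl

end Actions

section Assoc

variable {S Q : Type*} [Ring S] [Module Sᵐᵒᵖ N] [SMulCommClass R Sᵐᵒᵖ N]
  [AddCommGroup Q] [Module S Q]

/-- `(M ⊗_R N) ⊗_S Q → M ⊗_R (N ⊗_S Q)`, `(m ⊗ n) ⊗ q ↦ m ⊗ (n ⊗ q)`. -/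
def assocHom : BalTensor S (BalTensor R M N) Q →+ BalTensor R M (BalTensor S N Q) :=
  lift' (fun z q => lift' (fun m n => tmul R m (tmul S n q))
      (fun _ _ _ => add_tmul _ _ _) (fun _ _ _ => by rw [add_tmul, tmul_add])
      (fun m r n => by rw [smul_tmul, left_smul_tmul]) z)
    (fun _ _ _ => map_add _ _ _)
    (fun z q q' => by
      induction z using induction with
      | zero => simp
      | tmul m n => simp [tmul_add]
      | add x y hx hy => simp only [map_add, hx, hy]; abel)
    (fun z s q => by
      induction z using induction with
      | zero => simp
      | tmul m n => simp [smul_tmul]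
      | add x y hx hy => simp only [smul_add, map_add, hx, hy])

/-- `M ⊗_R (N ⊗_S Q) → (M ⊗_R N) ⊗_S Q`, `m ⊗ (n ⊗ q) ↦ (m ⊗ n) ⊗ q`. -/
def assocInv : BalTensor R M (BalTensor S N Q) →+ BalTensor S (BalTensor R M N) Q :=
  lift' (fun m z => lift' (fun n q => tmul S (tmul R m n) q)
      (fun _ _ _ => by rw [tmul_add, add_tmul]) (fun _ _ _ => tmul_add _ _ _)
      (fun n s q => by rw [← smul_tmul, right_smul_tmul]) z)
    (fun m m' z => by
      induction z using induction with
      | zero => simp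
      | tmul n q => simp [add_tmul]
      | add x y hx hy => simp only [map_add, hx, hy]; abel)
    (fun _ _ _ => map_add _ _ _)
    (fun m r z => by
      induction z using induction with
      | zero => simp
      | tmul n q => simp [smul_tmul]
      | add x y hx hy => simp only [smul_add, map_add, hx, hy])

@[simp] theorem assocHom_tmul (m : M) (n : N) (q : Q) :
    assocHom (tmul S (tmul R m n) q) = tmul R m (tmul S n q) :=
  rfl

@[simp] theorem assocInv_tmul (m : M) (n : N) (q : Q) :
    assocInv (tmul R m (tmul S n q)) = tmul S (tmul R m n) q :=
  rfl

/-- The associativity isomorphism `(M ⊗_R N) ⊗_S Q ≃ M ⊗_R (N ⊗_S Q)`. -/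
def assoc : BalTensor S (BalTensor R M N) Q ≃+ BalTensor R M (BalTensor S N Q) where
  toFun := assocHom
  invFun := assocInv
  left_inv z := by
    refine hom_ext_apply (f := assocInv.comp assocHom) (g := AddMonoidHom.id _) (fun w q => ?_) z
    induction w using induction with
    | zero => simp [zero_tmul]
    | tmul m n => rfl
    | add x y hx hy => rw [add_tmul, map_add, map_add, hx, hy]
  right_inv z := by
    refine hom_ext_apply (f := assocHom.comp assocInv) (g := AddMonoidHom.id _) (fun m w => ?_) z
    induction w using induction with
    | zero => simp [tmul_zero]
    | tmul n q => rfl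
    | add x y hx hy => rw [tmul_add, map_add, map_add, hx, hy]
  map_add' := map_add _

@[simp] theorem assoc_tmul (m : M) (n : N) (q : Q) :
    assoc (tmul S (tmul R m n) q) = tmul R m (tmul S n q) :=
  rfl

@[simp] theorem assoc_symm_tmul (m : M) (n : N) (q : Q) :
    assoc.symm (tmul R m (tmul S n q)) = tmul S (tmul R m n) q :=
  rfl

end Assoc

end BalTensor

end Tensor

/-! ### Corings and comodules -/

section Coring

open BalTensor

/-- An `A`-coring structure on the `A`-`A` bimodule `C`: a coassociative, counital, `A`-`A` bilinear
coproduct `C → C ⊗_A C` and counit `C → A`. -/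
class Coring (A : Type*) (C : Type*) [Ring A] [AddCommGroup C] [Module A C] [Module Aᵐᵒᵖ C]
    [SMulCommClass A Aᵐᵒᵖ C] where
  comul : C →+ BalTensor A C C
  comul_smul : ∀ (a : A) (c : C), comul (a • c) = a • comul c
  comul_op_smul : ∀ (a : Aᵐᵒᵖ) (c : C), comul (a • c) = a • comul c
  counit : C →ₗ[A] A
  counit_op_smul : ∀ (a : Aᵐᵒᵖ) (c : C), counit (a • c) = a • counit c
  coassoc : ∀ c : C,
    assoc (map (⟨⟨comul, map_add comul⟩, comul_op_smul⟩ : C →ₗ[Aᵐᵒᵖ] BalTensor A C C)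
      LinearMap.id (comul c)) =
    map LinearMap.id (⟨⟨comul, map_add comul⟩, comul_smul⟩ : C →ₗ[A] BalTensor A C C) (comul c)
  counit_left : ∀ c : C,
    lift' (fun (d e : C) => counit d • e) (fun _ _ _ => by rw [map_add, add_smul])
      (fun _ _ _ => smul_add _ _ _)
      (fun d a e => by rw [counit_op_smul, op_smul_eq_mul, mul_smul]) (comul c) = c
  counit_right : ∀ c : C,
    lift' (fun (d e : C) => op (counit e) • d) (fun _ _ _ => smul_add _ _ _)
      (fun _ _ _ => by rw [map_add, op_add, add_smul])
      (fun d a e => by rw [map_smul, smul_eq_mul, op_mul, mul_smul]) (comul c) = c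

variable (A : Type*) (C : Type*) [Ring A] [AddCommGroup C] [Module A C]

/-- The left dual `*C = _A Hom(C, A)` of a coring. -/
def LeftDual : Type _ := C →ₗ[A] A

variable {A C} in
/-- The linear map underlying an element of `*C`. -/
def LeftDual.toLin (f : LeftDual A C) : C →ₗ[A] A := f

instance : FunLike (LeftDual A C) C A := inferInstanceAs (FunLike (C →ₗ[A] A) C A)

instance : AddCommGroup (LeftDual A C) := inferInstanceAs (AddCommGroup (C →ₗ[A] A))

/-- The right `A`-action `(f · a)(c) = f(c) a` on `*C`. -/
instance : Module Aᵐᵒᵖ (LeftDual A C) := inferInstanceAs (Module Aᵐᵒᵖ (C →ₗ[A] A))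

variable {A C}

@[ext] theorem LeftDual.ext {f g : LeftDual A C} (h : ∀ c, f c = g c) : f = g :=
  LinearMap.ext h

theorem LeftDual.add_apply (f g : LeftDual A C) (c : C) : (f + g) c = f c + g c := rfl

theorem LeftDual.zero_apply (c : C) : (0 : LeftDual A C) c = 0 := rfl

theorem LeftDual.op_smul_apply (a : Aᵐᵒᵖ) (f : LeftDual A C) (c : C) :
    (a • f) c = f c * a.unop := rfl

theorem LeftDual.map_add (f : LeftDual A C) (c d : C) : f (c + d) = f c + f d :=
  LinearMap.map_add f.toLin c d

theorem LeftDual.map_zero (f : LeftDual A C) : f (0 : C) = 0 :=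
  LinearMap.map_zero f.toLin

theorem LeftDual.map_smul (f : LeftDual A C) (a : A) (c : C) : f (a • c) = a * f c :=
  LinearMap.map_smul f.toLin a c

variable (A C) [Module Aᵐᵒᵖ C] [SMulCommClass A Aᵐᵒᵖ C]

/-- The map `M ⊗_A C → M`, `m ⊗ c ↦ m · f(c)`, for a left `A`-linear map `f : C → A`. -/
def actMap {A C : Type*} [Ring A] [AddCommGroup C] [Module A C] (f : C →ₗ[A] A) (M : Type*)
    [AddCommGroup M] [Module Aᵐᵒᵖ M] : BalTensor A M C →+ M :=
  lift' (fun m c => op (f c) • m) (fun _ _ _ => smul_add _ _ _)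
    (fun _ _ _ => by rw [map_add, op_add, add_smul])
    (fun d a e => by rw [map_smul, smul_eq_mul, op_mul, mul_smul])

@[simp] theorem actMap_tmul {A C M : Type*} [Ring A] [AddCommGroup C] [Module A C]
    (f : C →ₗ[A] A) [AddCommGroup M] [Module Aᵐᵒᵖ M] (m : M) (c : C) :
    actMap f M (tmul A m c) = op (f c) • m :=
  rfl

/-- The coproduct as a left `A`-linear map. -/
def Coring.comulL [Coring A C] : C →ₗ[A] BalTensor A C C :=
  ⟨⟨comul, map_add comul⟩, comul_smul⟩

/-- The coproduct as a right `A`-linear map. -/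
def Coring.comulR [Coring A C] : C →ₗ[Aᵐᵒᵖ] BalTensor A C C :=
  ⟨⟨comul, map_add comul⟩, comul_op_smul⟩

/-- A right comodule structure over the `A`-coring `C` on a right `A`-module `M`: a coassociative,
counital, right `A`-linear coaction `M → M ⊗_A C`. -/
class RightComodule [Coring A C] (M : Type*) [AddCommGroup M] [Module Aᵐᵒᵖ M] where
  coact : M →ₗ[Aᵐᵒᵖ] BalTensor A M C
  coassoc : ∀ m : M,
    assoc (map coact LinearMap.id (coact m)) = map LinearMap.id (Coring.comulL A C) (coact m)
  counit : ∀ m : M, actMap (Coring.counit : C →ₗ[A] A) M (coact m) = m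

variable [Coring A C]

/-- The coring itself, as a right comodule via its coproduct. -/
instance : RightComodule A C C where
  coact := Coring.comulR A C
  coassoc := Coring.coassoc
  counit := Coring.counit_right

/-- The coaction `M → M ⊗_A C`. -/
abbrev coact {M : Type*} [AddCommGroup M] [Module Aᵐᵒᵖ M] [RightComodule A C M] :
    M →ₗ[Aᵐᵒᵖ] BalTensor A M C :=
  RightComodule.coact

/-- The group `Hom^C(M, N)` of right `C`-comodule maps. -/
def comoduleHom (M N : Type*) [AddCommGroup M] [Module Aᵐᵒᵖ M] [RightComodule A C M]
    [AddCommGroup N] [Module Aᵐᵒᵖ N] [RightComodule A C N] : AddSubgroup (M →ₗ[Aᵐᵒᵖ] N) where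
  carrier := {f | ∀ m, coact A C (f m) = map f LinearMap.id (coact A C m)}
  zero_mem' m := by simp [map_zero_left]
  add_mem' {f g} hf hg m := by
    rw [map_add_left, ← hf m, ← hg m, LinearMap.add_apply, _root_.map_add]
  neg_mem' {f} hf m := by
    have h := map_add_left f (-f) (LinearMap.id : C →ₗ[A] C) (coact A C m)
    rw [add_neg_cancel, map_zero_left, ← hf m] at h
    rw [LinearMap.neg_apply, _root_.map_neg]
    exact (eq_neg_of_add_eq_zero_right h.symm).symm

/-- The ring `T = End^C(M)` of comodule endomorphisms, with composition as multiplication. It acts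
on `M` from the left by evaluation. -/
def comodEnd (M : Type*) [AddCommGroup M] [Module Aᵐᵒᵖ M] [RightComodule A C M] :
    Subring (Module.End Aᵐᵒᵖ M) where
  __ := comoduleHom A C M M
  one_mem' m := (map_id _).symm
  mul_mem' {f g} hf hg m := by
    have h := map_comp f (LinearMap.id : C →ₗ[A] C) g (LinearMap.id : C →ₗ[A] C) (coact A C m)
    rw [LinearMap.comp_id] at h
    exact (hf (g m)).trans ((congrArg _ (hg m)).trans h.symm)

/-! ### The ring structure of the left dual and its action on comodules -/

variable {A C}

/-- The element `x · f = x⁽⁰⁾ f(x⁽¹⁾)` of a comodule `M`, for `x ∈ M` and `f ∈ *C`. -/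
def comoduleAct (M : Type*) [AddCommGroup M] [Module Aᵐᵒᵖ M] [RightComodule A C M]
    (f : LeftDual A C) : M →+ M :=
  (actMap f.toLin M).comp (coact A C : M →ₗ[Aᵐᵒᵖ] BalTensor A M C).toAddMonoidHom

theorem comoduleAct_add (M : Type*) [AddCommGroup M] [Module Aᵐᵒᵖ M] [RightComodule A C M]
    (f g : LeftDual A C) (x : M) :
    comoduleAct M (f + g) x = comoduleAct M f x + comoduleAct M g x :=
  hom_ext_apply (f := actMap (f + g).toLin M) (g := actMap f.toLin M + actMap g.toLin M)
    (fun m c => by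
      change op ((f + g) c) • m = op (f c) • m + op (g c) • m
      rw [LeftDual.add_apply, op_add, add_smul]) _

theorem comoduleAct_zero (M : Type*) [AddCommGroup M] [Module Aᵐᵒᵖ M] [RightComodule A C M]
    (x : M) : comoduleAct M (0 : LeftDual A C) x = 0 :=
  hom_ext_apply (f := actMap (0 : LeftDual A C).toLin M) (g := 0)
    (fun m c => by
      change op ((0 : LeftDual A C) c) • m = 0
      rw [LeftDual.zero_apply, op_zero, zero_smul]) _

/-- The map `c ↦ c⁽¹⁾ f(c⁽²⁾)` is left `A`-linear. -/
theorem comoduleAct_smul (f : LeftDual A C) (a : A) (c : C) :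
    comoduleAct C f (a • c) = a • comoduleAct C f c := by
  change actMap f.toLin C (Coring.comul (a • c)) = a • actMap f.toLin C (Coring.comul c)
  rw [Coring.comul_smul]
  exact map_left_smul (actMap f.toLin C) (fun a m c => (smul_comm a (op (f c)) m).symm) a _

/-- The multiplication `(f f')(c) = f'(c⁽¹⁾ f(c⁽²⁾))` of `*C`. -/
instance : Mul (LeftDual A C) where
  mul f f' :=
    ({ toFun := fun c => f' (comoduleAct C f c)
       map_add' := fun c d => by rw [_root_.map_add, LeftDual.map_add]
       map_smul' := fun a c => by
        rw [comoduleAct_smul, LeftDual.map_smul]; rfl } : C →ₗ[A] A)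

/-- The unit of `*C` is the counit of the coring. -/
instance : One (LeftDual A C) where
  one := (Coring.counit : C →ₗ[A] A)

theorem LeftDual.mul_apply (f f' : LeftDual A C) (c : C) :
    (f * f') c = f' (comoduleAct C f c) := rfl

theorem LeftDual.one_apply (c : C) : (1 : LeftDual A C) c = Coring.counit c := rfl

theorem comoduleAct_one (M : Type*) [AddCommGroup M] [Module Aᵐᵒᵖ M] [RightComodule A C M]
    (x : M) : comoduleAct M (1 : LeftDual A C) x = x :=
  RightComodule.counit x

/-- The map `C ⊗_A C → C`, `c ⊗ d ↦ c · f(d)`, is left `A`-linear. -/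
def actMapL (f : LeftDual A C) : BalTensor A C C →ₗ[A] C where
  __ := actMap f.toLin C
  map_smul' := map_left_smul (actMap f.toLin C) fun a m c => (smul_comm a (op (f c)) m).symm

/-- The left `A`-linear map `C → C`, `c ↦ c⁽¹⁾ f(c⁽²⁾)`. -/
def comoduleActL (f : LeftDual A C) : C →ₗ[A] C where
  __ := comoduleAct C f
  map_smul' := comoduleAct_smul f

/-- The coaction of `m⁽⁰⁾ f(m⁽¹⁾)` is `m⁽⁰⁾ ⊗ m⁽¹⁾ f(m⁽²⁾)`. -/
theorem coact_comoduleAct (M : Type*) [AddCommGroup M] [Module Aᵐᵒᵖ M] [RightComodule A C M]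
    (f : LeftDual A C) (x : M) :
    coact A C (comoduleAct M f x) = map LinearMap.id (comoduleActL f) (coact A C x) := by
  have key : ∀ z : BalTensor A (BalTensor A M C) C,
      actMap f.toLin (BalTensor A M C) z = map LinearMap.id (actMapL f) (assoc z) := by
    intro z
    refine hom_ext_apply (f := actMap f.toLin (BalTensor A M C)) (g := AddMonoidHom.comp
      (map LinearMap.id (actMapL f)) assoc.toAddMonoidHom) (fun w c => ?_) z
    induction w using BalTensor.induction with
    | zero => rw [zero_tmul, _root_.map_zero, _root_.map_zero]
    | tmul m d => rfl
    | add u v hu hv => rw [add_tmul, _root_.map_add, _root_.map_add, hu, hv]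
  have lin : ∀ z : BalTensor A M C, coact A C (actMap f.toLin M z) =
      actMap f.toLin (BalTensor A M C) (map (coact A C) LinearMap.id z) := fun z =>
    hom_ext_apply (f := (coact A C : M →ₗ[Aᵐᵒᵖ] BalTensor A M C).toAddMonoidHom.comp
        (actMap f.toLin M))
      (g := (actMap f.toLin (BalTensor A M C)).comp (map (coact A C) LinearMap.id))
      (fun m c => LinearMap.map_smul _ (op (f c)) m) z
  change coact A C (actMap f.toLin M (coact A C x)) = _
  rw [lin, key, RightComodule.coassoc, ← map_comp]
  rfl

theorem comoduleAct_mul (M : Type*) [AddCommGroup M] [Module Aᵐᵒᵖ M] [RightComodule A C M]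
    (f f' : LeftDual A C) (x : M) :
    comoduleAct M (f * f') x = comoduleAct M f' (comoduleAct M f x) := by
  change _ = actMap f'.toLin M (coact A C (comoduleAct M f x))
  rw [coact_comoduleAct]
  exact hom_ext_apply (f := actMap (f * f').toLin M) (g := (actMap f'.toLin M).comp
    (map LinearMap.id (comoduleActL f))) (fun m c => rfl) (coact A C x)

/-- The action of `*C` on comodules is compatible with the right `A`-action on `*C`. -/
theorem comoduleAct_op_smul (M : Type*) [AddCommGroup M] [Module Aᵐᵒᵖ M] [RightComodule A C M]
    (a : Aᵐᵒᵖ) (f : LeftDual A C) (x : M) :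
    comoduleAct M (a • f) x = a • comoduleAct M f x :=
  hom_ext_apply (f := actMap (a • f).toLin M)
    (g := (DistribSMul.toAddMonoidHom M a).comp (actMap f.toLin M))
    (fun m c => by
      change op (f c * a.unop) • m = a • op (f c) • m
      rw [op_mul, op_unop, mul_smul]) (coact A C x)

/-- Comodule maps are `*C`-linear. -/
theorem map_comoduleAct {M N : Type*} [AddCommGroup M] [Module Aᵐᵒᵖ M] [RightComodule A C M]
    [AddCommGroup N] [Module Aᵐᵒᵖ N] [RightComodule A C N] (t : M →ₗ[Aᵐᵒᵖ] N)
    (ht : t ∈ comoduleHom A C M N) (f : LeftDual A C) (x : M) :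
    t (comoduleAct M f x) = comoduleAct N f (t x) := by
  change _ = actMap f.toLin N (coact A C (t x))
  rw [ht x]
  exact hom_ext_apply (f := t.toAddMonoidHom.comp (actMap f.toLin M))
    (g := (actMap f.toLin N).comp (map t LinearMap.id))
    (fun m c => LinearMap.map_smul t (op (f c)) m) (coact A C x)

/-- The ring `*C`. -/
instance : Ring (LeftDual A C) where
  __ := (inferInstance : AddCommGroup (LeftDual A C))
  __ := (inferInstance : Mul (LeftDual A C))
  __ := (inferInstance : One (LeftDual A C))
  left_distrib f g h := by
    ext c; rfl
  right_distrib f g h := by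
    ext c
    rw [LeftDual.mul_apply, comoduleAct_add, LeftDual.map_add]; rfl
  zero_mul f := by
    ext c
    rw [LeftDual.mul_apply, comoduleAct_zero, LeftDual.map_zero]; rfl
  mul_zero f := by
    ext c; rfl
  mul_assoc f g h := by
    ext c
    rw [LeftDual.mul_apply, LeftDual.mul_apply, LeftDual.mul_apply, comoduleAct_mul]
  one_mul f := by
    ext c
    rw [LeftDual.mul_apply, comoduleAct_one]
  mul_one f := by
    ext c
    change Coring.counit (actMap f.toLin C (Coring.comul c)) = f c
    refine (hom_ext_apply (f := (Coring.counit : C →ₗ[A] A).toAddMonoidHom.comp (actMap f.toLin C))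
      (g := f.toLin.toAddMonoidHom.comp (lift' (fun (d e : C) => Coring.counit (A := A) d • e)
        (fun _ _ _ => by rw [_root_.map_add, add_smul]) (fun _ _ _ => smul_add _ _ _)
        (fun d a e => by rw [Coring.counit_op_smul, op_smul_eq_mul, mul_smul])))
      (fun d e => by
        change Coring.counit (op (f e) • d) = f (Coring.counit (A := A) d • e)
        rw [Coring.counit_op_smul, LeftDual.map_smul, op_smul_eq_mul]) (Coring.comul c)).trans ?_
    exact congrArg f (Coring.counit_left c)

/-- Every right `C`-comodule is a right `*C`-module by `x · f = x⁽⁰⁾ f(x⁽¹⁾)`. -/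
instance comoduleModule (M : Type*) [AddCommGroup M] [Module Aᵐᵒᵖ M] [RightComodule A C M] :
    Module (LeftDual A C)ᵐᵒᵖ M where
  smul f x := comoduleAct M f.unop x
  one_smul x := comoduleAct_one M x
  mul_smul f g x := comoduleAct_mul M g.unop f.unop x
  smul_zero _ := map_zero _
  smul_add _ := map_add _
  add_smul f g x := comoduleAct_add M f.unop g.unop x
  zero_smul x := comoduleAct_zero M x

/-! ### The bimodule `Q` -/

variable (A C)

section Sigma

variable (X : Type*) [AddCommGroup X] [Module Aᵐᵒᵖ X] [RightComodule A C X]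

variable {A C X} in
/-- The map `X ⊗_A C → C`, `x ⊗ d ↦ q(x)(c) d`. -/
def qMap (q : X →ₗ[Aᵐᵒᵖ] LeftDual A C) (c : C) : BalTensor A X C →+ C :=
  lift' (fun (y : X) (d : C) => q y c • d)
    (fun y y' d => by rw [_root_.map_add, LeftDual.add_apply, add_smul])
    (fun _ _ _ => smul_add _ _ _)
    (fun y a d => by rw [_root_.map_smul, LeftDual.op_smul_apply, unop_op, mul_smul])

/-- The group `Q` of right `A`-linear maps `q : X → *C` such that
`q(x⁽⁰⁾)(c) x⁽¹⁾ = c⁽¹⁾ q(x)(c⁽²⁾)` for all `x ∈ X` and `c ∈ C`. -/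
def moritaQ : AddSubgroup (X →ₗ[Aᵐᵒᵖ] LeftDual A C) where
  carrier := {q | ∀ (x : X) (c : C), qMap q c (coact A C x) = comoduleAct C (q x) c}
  zero_mem' x c := by
    refine Eq.trans ?_ (comoduleAct_zero C c).symm
    exact hom_ext_apply (f := qMap 0 c) (g := 0) (fun y d => (zero_smul A d : (0 : A) • d = 0)) _
  add_mem' {q q'} hq hq' x c := by
    refine Eq.trans ?_ (comoduleAct_add C (q x) (q' x) c).symm
    rw [← hq x c, ← hq' x c]
    exact hom_ext_apply (f := qMap (q + q') c) (g := qMap q c + qMap q' c)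
      (fun y d => (add_smul (q y c) (q' y c) d)) _
  neg_mem' {q} hq x c := by
    have h := comoduleAct_add C (q x) (-q x) c
    rw [add_neg_cancel, comoduleAct_zero, ← hq x c] at h
    refine Eq.trans ?_ (eq_neg_of_add_eq_zero_right h.symm).symm
    exact hom_ext_apply (f := qMap (-q) c) (g := -qMap q c)
      (fun y d => (neg_smul (q y c) d)) _

variable {A C X}

/-- Elements of `Q` are right `*C`-linear. -/
theorem moritaQ_comoduleAct (q : moritaQ A C X) (f : LeftDual A C) (x : X) :
    q.1 (comoduleAct X f x) = q.1 x * f := by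
  ext c
  rw [LeftDual.mul_apply, ← q.2 x c]
  refine hom_ext_apply (f := AddMonoidHom.mk' (fun w => q.1 (actMap f.toLin X w) c) ?_)
    (g := f.toLin.toAddMonoidHom.comp (qMap q.1 c)) (fun y d => ?_) (coact A C x)
  · intro w w'
    rw [_root_.map_add, _root_.map_add, LeftDual.add_apply]
  · change q.1 (op (f d) • y) c = f (q.1 y c • d)
    rw [_root_.map_smul, LeftDual.op_smul_apply, LeftDual.map_smul, unop_op]

/-- The left `*C`-action `(f q)(x) = f q(x)` on `Q`. -/
instance : Module (LeftDual A C) (moritaQ A C X) where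
  smul f q := ⟨⟨⟨fun x => f * q.1 x, fun x y => by rw [_root_.map_add, mul_add]⟩,
      fun a x => congrArg (f * ·) (_root_.map_smul q.1 a x)⟩, fun x c => by
    change _ = comoduleAct C (f * q.1 x) c
    rw [comoduleAct_mul]
    exact q.2 x (comoduleAct C f c)⟩
  one_smul q := Subtype.ext (LinearMap.ext fun x => one_mul (q.1 x))
  mul_smul f g q := Subtype.ext (LinearMap.ext fun x => mul_assoc f g (q.1 x))
  smul_zero f := Subtype.ext (LinearMap.ext fun _ => mul_zero f)
  smul_add f q q' := Subtype.ext (LinearMap.ext fun x => mul_add f (q.1 x) (q'.1 x))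
  add_smul f g q := Subtype.ext (LinearMap.ext fun x => add_mul f g (q.1 x))
  zero_smul q := Subtype.ext (LinearMap.ext fun x => zero_mul (q.1 x))

/-- The right `T`-action `(q t)(x) = q(t(x))` on `Q`, where `T = End^C(X)`. -/
instance : Module (comodEnd A C X)ᵐᵒᵖ (moritaQ A C X) where
  smul t q := ⟨q.1 ∘ₗ t.unop.1, fun x c => by
    change _ = comoduleAct C (q.1 (t.unop.1 x)) c
    rw [← q.2, t.unop.2 x]
    exact hom_ext_apply (f := qMap (q.1 ∘ₗ t.unop.1) c)
      (g := (qMap q.1 c).comp (map t.unop.1 LinearMap.id)) (fun _ _ => rfl) _⟩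
  one_smul q := rfl
  mul_smul s t q := rfl
  smul_zero t := rfl
  smul_add t q q' := rfl
  add_smul s t q := Subtype.ext (LinearMap.ext fun x => _root_.map_add q.1 (s.unop.1 x) (t.unop.1 x))
  zero_smul q := Subtype.ext (LinearMap.ext fun _ => _root_.map_zero q.1)

instance : SMulCommClass (LeftDual A C) (comodEnd A C X)ᵐᵒᵖ (moritaQ A C X) where
  smul_comm _ _ _ := rfl

instance : SMulCommClass (comodEnd A C X) (LeftDual A C)ᵐᵒᵖ X where
  smul_comm t f x := map_comoduleAct t.1 t.2 f.unop x

/-- For `w = ∑ m ⊗ c ∈ M ⊗_A C` and `q : X → *C`, the map `X → M`, `y ↦ ∑ m q(y)(c)`. -/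
def actLin (q : X →ₗ[Aᵐᵒᵖ] LeftDual A C) {M : Type*} [AddCommGroup M] [Module Aᵐᵒᵖ M]
    (w : BalTensor A M C) : X →ₗ[Aᵐᵒᵖ] M where
  toFun y := actMap (q y).toLin M w
  map_add' y y' := hom_ext_apply (f := actMap (q (y + y')).toLin M)
    (g := actMap (q y).toLin M + actMap (q y').toLin M) (fun m c => by
      change op (q (y + y') c) • m = op (q y c) • m + op (q y' c) • m
      rw [_root_.map_add, LeftDual.add_apply, op_add, add_smul]) w
  map_smul' a y := hom_ext_apply (f := actMap (q (a • y)).toLin M)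
    (g := (DistribSMul.toAddMonoidHom M a).comp (actMap (q y).toLin M)) (fun m c => by
      change op (q (a • y) c) • m = a • op (q y c) • m
      rw [_root_.map_smul, LeftDual.op_smul_apply, op_mul, op_unop, mul_smul]) w

theorem actLin_mem (q : moritaQ A C X) {M : Type*} [AddCommGroup M] [Module Aᵐᵒᵖ M]
    [RightComodule A C M] (m : M) : actLin q.1 (coact A C m) ∈ comoduleHom A C X M := by
  intro y
  change coact A C (comoduleAct M (q.1 y) m) = _
  rw [coact_comoduleAct]
  generalize coact A C m = w
  induction w using BalTensor.induction with
  | zero =>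
    have : actLin q.1 (0 : BalTensor A M C) = 0 := LinearMap.ext fun y => _root_.map_zero (actMap (q.1 y).toLin M)
    rw [this, map_zero_left, _root_.map_zero]
  | tmul m c =>
    change tmul A m (comoduleAct C (q.1 y) c) = _
    rw [← q.2 y c]
    refine hom_ext_apply (f := AddMonoidHom.mk' (fun z => tmul A m (qMap q.1 c z)) ?_)
      (g := map (actLin q.1 (tmul A m c)) LinearMap.id) (fun x d => ?_) (coact A C y)
    · intro z z'
      rw [_root_.map_add, tmul_add]
    · change tmul A m (q.1 x c • d) = tmul A (op (q.1 x c) • m) d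
      rw [smul_tmul]
  | add u v hu hv =>
    have : actLin q.1 (u + v) = actLin q.1 u + actLin q.1 v :=
      LinearMap.ext fun y => _root_.map_add (actMap (q.1 y).toLin M) u v
    rw [_root_.map_add, hu, hv, this, map_add_left]

end Sigma

end Coring

/-! ### Morita contexts -/

section Morita

open BalTensor

/-- A Morita context connecting the rings `T` and `S`: a `T`-`S` bimodule `P`, an `S`-`T` bimodule
`Q`, and bimodule maps `Q ⊗_T P → S` and `P ⊗_S Q → T` satisfying the two associativity laws. -/
structure MoritaContext (T S P Q : Type*) [Ring T] [Ring S] [AddCommGroup P] [AddCommGroup Q]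
    [Module T P] [Module Sᵐᵒᵖ P] [SMulCommClass T Sᵐᵒᵖ P]
    [Module S Q] [Module Tᵐᵒᵖ Q] [SMulCommClass S Tᵐᵒᵖ Q] where
  /-- The connecting map `Q ⊗_T P → S`. -/
  toS : BalTensor T Q P →+ S
  /-- The connecting map `P ⊗_S Q → T`. -/
  toT : BalTensor S P Q →+ T
  toS_smul : ∀ (s : S) z, toS (s • z) = s • toS z
  toS_op_smul : ∀ (s : Sᵐᵒᵖ) z, toS (s • z) = s • toS z
  toT_smul : ∀ (t : T) z, toT (t • z) = t • toT z
  toT_op_smul : ∀ (t : Tᵐᵒᵖ) z, toT (t • z) = t • toT z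
  assoc_P : ∀ (p : P) (q : Q) (p' : P), toT (tmul S p q) • p' = op (toS (tmul T q p')) • p
  assoc_Q : ∀ (q : Q) (p : P) (q' : Q), toS (tmul T q p) • q' = op (toT (tmul S p q')) • q

/-- A Morita context is strict if both connecting maps are isomorphisms. -/
def MoritaContext.IsStrict {T S P Q : Type*} [Ring T] [Ring S] [AddCommGroup P] [AddCommGroup Q]
    [Module T P] [Module Sᵐᵒᵖ P] [SMulCommClass T Sᵐᵒᵖ P]
    [Module S Q] [Module Tᵐᵒᵖ Q] [SMulCommClass S Tᵐᵒᵖ Q] (m : MoritaContext T S P Q) : Prop :=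
  Function.Bijective m.toS ∧ Function.Bijective m.toT

variable (A : Type*) (C : Type*) [Ring A] [AddCommGroup C] [Module A C] [Module Aᵐᵒᵖ C]
  [SMulCommClass A Aᵐᵒᵖ C] [Coring A C]
  (X : Type*) [AddCommGroup X] [Module Aᵐᵒᵖ X] [RightComodule A C X]

/-- The Morita context `(T, *C, X, Q)` of a comodule `X`, with connecting maps
`q ⊗ x ↦ q(x)` and `x ⊗ q ↦ (y ↦ x · q(y) = x⁽⁰⁾ q(y)(x⁽¹⁾))`. -/
def moritaContext :
    MoritaContext (comodEnd A C X) (LeftDual A C) X (moritaQ A C X) where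
  toS := lift' (fun (q : moritaQ A C X) (x : X) => q.1 x) (fun _ _ _ => rfl)
    (fun q _ _ => _root_.map_add q.1 _ _) (fun _ _ _ => rfl)
  toT := lift' (fun (x : X) (q : moritaQ A C X) =>
      (⟨actLin q.1 (coact A C x), actLin_mem q x⟩ : comodEnd A C X))
    (fun x x' q => Subtype.ext (LinearMap.ext fun y => _root_.map_add (comoduleAct X (q.1 y)) x x'))
    (fun x q q' => Subtype.ext (LinearMap.ext fun y => comoduleAct_add X (q.1 y) (q'.1 y) x))
    (fun x f q => Subtype.ext (LinearMap.ext fun y => (comoduleAct_mul X f (q.1 y) x).symm))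
  toS_smul := map_left_smul _ fun _ _ _ => rfl
  toS_op_smul := map_right_smul _ fun f q x => moritaQ_comoduleAct q f.unop x
  toT_smul := map_left_smul _ fun t x q => Subtype.ext (LinearMap.ext fun y =>
    (map_comoduleAct t.1 t.2 (q.1 y) x).symm)
  toT_op_smul := map_right_smul _ fun _ _ _ => rfl
  assoc_P _ _ _ := rfl
  assoc_Q q x q' := Subtype.ext (LinearMap.ext fun y => (moritaQ_comoduleAct q (q'.1 y) x).symm)

end Morita

/-! ### Galois comodules and faithful flatness -/

section Galois

open BalTensor

variable {A : Type*} {C : Type*} [Ring A] [AddCommGroup C] [Module A C] [Module Aᵐᵒᵖ C]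
  [SMulCommClass A Aᵐᵒᵖ C] [Coring A C]

/-- The right `T`-action `(f t)(x) = f(t(x))` on `Hom_A(X, N)`, where `T = End^C(X)`. -/
instance homModule {X : Type*} [AddCommGroup X] [Module Aᵐᵒᵖ X] [RightComodule A C X] {N : Type*}
    [AddCommGroup N] [Module Aᵐᵒᵖ N] : Module (comodEnd A C X)ᵐᵒᵖ (X →ₗ[Aᵐᵒᵖ] N) where
  smul t f := f ∘ₗ t.unop.1
  one_smul _ := rfl
  mul_smul _ _ _ := rfl
  smul_zero _ := rfl
  smul_add _ _ _ := rfl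
  add_smul s t f := LinearMap.ext fun x => _root_.map_add f (s.unop.1 x) (t.unop.1 x)
  zero_smul f := LinearMap.ext fun _ => _root_.map_zero f

variable (A C)

/-- The canonical map `Hom_A(X, N) ⊗_T X → N ⊗_A C`, `φ ⊗ x ↦ φ(x⁽⁰⁾) ⊗ x⁽¹⁾`. -/
def can (X : Type*) [AddCommGroup X] [Module Aᵐᵒᵖ X] [RightComodule A C X] (N : Type*)
    [AddCommGroup N] [Module Aᵐᵒᵖ N] :
    BalTensor (comodEnd A C X) (X →ₗ[Aᵐᵒᵖ] N) X →+ BalTensor A N C :=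
  lift' (fun (φ : X →ₗ[Aᵐᵒᵖ] N) (x : X) => map φ LinearMap.id (coact A C x))
    (fun _ _ _ => map_add_left _ _ _ _)
    (fun _ _ _ => by rw [_root_.map_add, _root_.map_add])
    (fun φ t x => by
      change _ = map φ LinearMap.id (coact A C (t.1 x))
      rw [t.2 x, ← map_comp]
      rfl)

variable {A C}

/-- The composite of two comodule maps. -/
def comoduleHomComp {M N P : Type*} [AddCommGroup M] [Module Aᵐᵒᵖ M] [RightComodule A C M]
    [AddCommGroup N] [Module Aᵐᵒᵖ N] [RightComodule A C N]
    [AddCommGroup P] [Module Aᵐᵒᵖ P] [RightComodule A C P]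
    (f : comoduleHom A C M N) (g : comoduleHom A C N P) : comoduleHom A C M P :=
  ⟨g.1 ∘ₗ f.1, fun m => by
    change coact A C (g.1 (f.1 m)) = _
    rw [g.2, f.2, ← map_comp]
    rfl⟩

/-- The right `T`-module `Hom^C(X, M)`, with action `(φ t)(x) = φ(t(x))`. -/
instance comoduleHomModule {X : Type*} [AddCommGroup X] [Module Aᵐᵒᵖ X] [RightComodule A C X]
    {M : Type*} [AddCommGroup M] [Module Aᵐᵒᵖ M] [RightComodule A C M] :
    Module (comodEnd A C X)ᵐᵒᵖ (comoduleHom A C X M) where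
  smul t φ := comoduleHomComp (M := X) ⟨t.unop.1, t.unop.2⟩ φ
  one_smul _ := rfl
  mul_smul _ _ _ := rfl
  smul_zero _ := rfl
  smul_add _ _ _ := rfl
  add_smul s t φ := Subtype.ext (LinearMap.ext fun x =>
    _root_.map_add φ.1 (s.unop.1 x) (t.unop.1 x))
  zero_smul φ := Subtype.ext (LinearMap.ext fun _ => _root_.map_zero φ.1)

variable {X : Type*} [AddCommGroup X] [Module Aᵐᵒᵖ X] [RightComodule A C X]
  {N : Type*} [AddCommGroup N] [Module (comodEnd A C X)ᵐᵒᵖ N]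

/-- For `n ∈ N`, the right `A`-linear map `X → N ⊗_T X`, `x ↦ n ⊗ x`. -/
def tmulLin (A C X : Type*) [Ring A] [AddCommGroup C] [Module A C] [Module Aᵐᵒᵖ C]
    [SMulCommClass A Aᵐᵒᵖ C] [Coring A C] [AddCommGroup X] [Module Aᵐᵒᵖ X] [RightComodule A C X]
    {N : Type*} [AddCommGroup N] [Module (comodEnd A C X)ᵐᵒᵖ N] (n : N) :
    X →ₗ[Aᵐᵒᵖ] BalTensor (comodEnd A C X) N X where
  toFun x := tmul (comodEnd A C X) n x
  map_add' := tmul_add n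
  map_smul' _ _ := rfl

theorem tmulLin_add (n n' : N) :
    (tmulLin A C X (n + n') : X →ₗ[Aᵐᵒᵖ] BalTensor (comodEnd A C X) N X) =
    tmulLin A C X n + tmulLin A C X n' :=
  LinearMap.ext fun x => add_tmul n n' x

theorem tmulLin_smul (n : N) (t : comodEnd A C X) :
    (tmulLin A C X (op t • n) : X →ₗ[Aᵐᵒᵖ] BalTensor (comodEnd A C X) N X) = tmulLin A C X n ∘ₗ t.1 :=
  LinearMap.ext fun x => smul_tmul n t x

/-- The coaction `n ⊗ x ↦ (n ⊗ x⁽⁰⁾) ⊗ x⁽¹⁾` on `N ⊗_T X`. -/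
def tensorCoact : BalTensor (comodEnd A C X) N X →ₗ[Aᵐᵒᵖ]
    BalTensor A (BalTensor (comodEnd A C X) N X) C where
  __ := lift' (fun (n : N) (x : X) => map (tmulLin A C X n) (LinearMap.id : C →ₗ[A] C) (coact A C x))
    (fun n n' x => by rw [tmulLin_add, map_add_left])
    (fun _ _ _ => by rw [_root_.map_add, _root_.map_add])
    (fun n t x => by
      rw [tmulLin_smul]
      change _ = map _ _ (coact A C (t.1 x))
      rw [t.2 x, ← map_comp]
      rfl)
  map_smul' := map_right_smul (lift' _ _ _ _) fun a n x => by
    change map _ _ (coact A C (a • x)) = a • map _ _ (coact A C x)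
    rw [_root_.map_smul]
    exact (rTensor (S := A) C (tmulLin A C X n)).map_smul a _

theorem tensorCoact_tmul (n : N) (x : X) :
    tensorCoact (A := A) (C := C) (tmul (comodEnd A C X) n x) =
      map (tmulLin A C X n) LinearMap.id (coact A C x) :=
  rfl

/-- The right `C`-comodule `N ⊗_T X`. -/
instance tensorComodule : RightComodule A C (BalTensor (comodEnd A C X) N X) where
  coact := tensorCoact
  coassoc z := by
    refine hom_ext_apply (f := (assoc.toAddMonoidHom.comp
        (map (tensorCoact (N := N)) LinearMap.id)).comp
        (tensorCoact (A := A) (C := C) (X := X) (N := N)).toAddMonoidHom)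
      (g := (map LinearMap.id (Coring.comulL A C)).comp
        (tensorCoact (A := A) (C := C) (X := X) (N := N)).toAddMonoidHom)
      (fun n x => ?_) z
    change assoc (map (tensorCoact (N := N)) LinearMap.id
        (map (tmulLin A C X n) LinearMap.id (coact A C x))) =
      map LinearMap.id (Coring.comulL A C) (map (tmulLin A C X n) LinearMap.id (coact A C x))
    have h : map LinearMap.id (Coring.comulL A C) (map (tmulLin A C X n) LinearMap.id (coact A C x)) =
        map (tmulLin A C X n) LinearMap.id (map LinearMap.id (Coring.comulL A C) (coact A C x)) := by
      rw [← map_comp, ← map_comp]; rfl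
    have h' : map (tensorCoact (N := N)) LinearMap.id
        (map (tmulLin A C X n) LinearMap.id (coact A C x)) =
        map (rTensor (S := A) C (tmulLin A C X n)) (LinearMap.id : C →ₗ[A] C)
          (map (coact A C) LinearMap.id (coact A C x)) := by
      rw [← map_comp, ← map_comp]; rfl
    rw [h, h', ← RightComodule.coassoc]
    refine hom_ext_apply (f := assoc.toAddMonoidHom.comp
        (map (rTensor (S := A) C (tmulLin A C X n)) (LinearMap.id : C →ₗ[A] C)))
      (g := (map (tmulLin A C X n) LinearMap.id).comp assoc.toAddMonoidHom) (fun w c => ?_)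
      (map (coact A C) LinearMap.id (coact A C x))
    induction w using BalTensor.induction with
    | zero => rw [zero_tmul, _root_.map_zero, _root_.map_zero]
    | tmul y d => rfl
    | add u v hu hv => rw [add_tmul, _root_.map_add, _root_.map_add, hu, hv]
  counit z := by
    refine hom_ext_apply (f := (actMap (Coring.counit : C →ₗ[A] A) _).comp
      (tensorCoact (A := A) (C := C) (X := X) (N := N)).toAddMonoidHom) (g := AddMonoidHom.id _) (fun n x => ?_) z
    change actMap (Coring.counit : C →ₗ[A] A) _ (map (tmulLin A C X n) LinearMap.id (coact A C x)) =
      tmul _ n x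
    have h : ∀ w : BalTensor A X C, actMap (Coring.counit : C →ₗ[A] A) _
        (map (tmulLin A C X n) LinearMap.id w) =
        tmulLin A C X n (actMap (Coring.counit : C →ₗ[A] A) X w) := fun w =>
      hom_ext_apply (f := (actMap (Coring.counit : C →ₗ[A] A) _).comp
          (map (tmulLin A C X n) LinearMap.id))
        (g := (tmulLin A C X n).toAddMonoidHom.comp (actMap (Coring.counit : C →ₗ[A] A) X))
        (fun _ _ => rfl) w
    rw [h, RightComodule.counit]
    rfl

/-- `f ⊗_T X` is a comodule map, for every right `T`-linear map `f`. -/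
theorem rTensor_mem {N' : Type*} [AddCommGroup N'] [Module (comodEnd A C X)ᵐᵒᵖ N']
    (f : N →ₗ[(comodEnd A C X)ᵐᵒᵖ] N') :
    rTensor X f ∈ comoduleHom A C (BalTensor (comodEnd A C X) N X)
      (BalTensor (comodEnd A C X) N' X) := fun z =>
  hom_ext_apply (f := (tensorCoact (A := A) (C := C) (X := X) (N := N')).toAddMonoidHom.comp
      (rTensor (S := A) X f).toAddMonoidHom)
    (g := (map (rTensor X f) LinearMap.id).comp
      (tensorCoact (A := A) (C := C) (X := X)).toAddMonoidHom)
    (fun n x => by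
      change map (tmulLin A C X (f n)) LinearMap.id (coact A C x) =
        map (rTensor X f) LinearMap.id (map (tmulLin A C X n) LinearMap.id (coact A C x))
      rw [← map_comp]
      rfl) z

end Galois

/-- A comodule `X` is a Galois comodule if the canonical map
`Hom_A(X, N) ⊗_T X → N ⊗_A C` is bijective for every right `A`-module `N`. -/
def IsGaloisComodule (A C : Type u) [Ring A] [AddCommGroup C] [Module A C] [Module Aᵐᵒᵖ C]
    [SMulCommClass A Aᵐᵒᵖ C] [Coring A C] (X : Type u) [AddCommGroup X] [Module Aᵐᵒᵖ X]
    [RightComodule A C X] : Prop :=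
  ∀ (N : Type u) [AddCommGroup N] [Module Aᵐᵒᵖ N], Function.Bijective (can A C X N)

/-- A left `R`-module `P` is faithfully flat if a sequence of right `R`-modules is exact if and only
if it is exact after applying `- ⊗_R P`. -/
def IsFaithfullyFlat (R P : Type u) [Ring R] [AddCommGroup P] [Module R P] : Prop :=
  ∀ (N₁ N₂ N₃ : Type u) [AddCommGroup N₁] [AddCommGroup N₂] [AddCommGroup N₃]
    [Module Rᵐᵒᵖ N₁] [Module Rᵐᵒᵖ N₂] [Module Rᵐᵒᵖ N₃]
    (f : N₁ →ₗ[Rᵐᵒᵖ] N₂) (g : N₂ →ₗ[Rᵐᵒᵖ] N₃),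
    Function.Exact f g ↔ Function.Exact
      (BalTensor.map f (LinearMap.id : P →ₗ[R] P)) (BalTensor.map g (LinearMap.id : P →ₗ[R] P))

/-! ### The category of comodules and the two functors -/

section Category

open CategoryTheory

variable (A C : Type u) [Ring A] [AddCommGroup C] [Module A C] [Module Aᵐᵒᵖ C]
  [SMulCommClass A Aᵐᵒᵖ C] [Coring A C]

/-- The objects of the category of right `C`-comodules. -/
structure ComodCat where
  carrier : Type u
  [isAddCommGroup : AddCommGroup carrier]
  [isModule : Module Aᵐᵒᵖ carrier]
  [isComodule : RightComodule A C carrier]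

attribute [instance] ComodCat.isAddCommGroup ComodCat.isModule ComodCat.isComodule

/-- The category of right `C`-comodules and comodule maps. -/
instance : Category (ComodCat A C) where
  Hom M N := comoduleHom A C M.carrier N.carrier
  id M := ⟨LinearMap.id, (comodEnd A C M.carrier).one_mem⟩
  comp f g := comoduleHomComp f g
  id_comp _ := rfl
  comp_id _ := rfl
  assoc _ _ _ := rfl

variable (X : Type u) [AddCommGroup X] [Module Aᵐᵒᵖ X] [RightComodule A C X]

/-- The functor `- ⊗_T X : M_T ⥤ M^C`, where `T = End^C(X)`. -/
def tensorFunctor : ModuleCat.{u} (comodEnd A C X)ᵐᵒᵖ ⥤ ComodCat A C where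
  obj N := ⟨BalTensor (comodEnd A C X) N X⟩
  map f := ⟨BalTensor.rTensor X f.hom, rTensor_mem f.hom⟩
  map_id N := Subtype.ext (LinearMap.ext fun z => BalTensor.map_id z)
  map_comp f g := Subtype.ext (LinearMap.ext fun z =>
    BalTensor.map_comp g.hom LinearMap.id f.hom LinearMap.id z)

/-- The functor `Hom^C(X, -) : M^C ⥤ M_T`, where `T = End^C(X)`. -/
def homFunctor : ComodCat A C ⥤ ModuleCat.{u} (comodEnd A C X)ᵐᵒᵖ where
  obj M := ModuleCat.of _ (comoduleHom A C X M.carrier)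
  map g := ModuleCat.ofHom
    { toFun := fun φ => comoduleHomComp φ g
      map_add' := fun φ ψ => Subtype.ext (LinearMap.ext fun x =>
        _root_.map_add (Subtype.val g) (φ.1 x) (ψ.1 x))
      map_smul' := fun _ _ => rfl }

end Category

end CoringMorita

open CoringMorita

/-!
If an element of `Q ⊗_T X` lies over `1 ∈ *C`, then contracting with it inverts the natural maps
`N ⊗_T X → Hom_T(Q, N)` on their image. This makes `Q ⊗_T X → *C` injective, `- ⊗_T X` exact and the
Galois maps bijective; the element itself yields a dual basis of `C` over `A`. An element over
`1 ∈ T` yields a dual basis of `X` over `A` and the faithfulness of `- ⊗_T X`.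

Under the Galois condition `- ⊗_T X` sends the equalizer presentation of `Hom^C(X, M)` inside
`Hom_A(X, M)` to the one of `M` inside `M ⊗_A C`, so flatness makes the counit of the adjunction
bijective, and faithfulness then does the same for the unit.

Conversely a dual basis of `C` makes `*C` a comodule with `Hom^C(X, *C) ⊆ Q`, so the counit at `*C`
factors through `Q ⊗_T X → *C`, which is therefore onto. If `I` is the image of the other connecting
map, then `T/I ⊗_T X = 0`, and injectivity of the unit at `T/I` forces `I = T`.
-/

namespace CoringMorita

open BalTensor

namespace BalTensor

variable {R M N M' N' : Type*} [Ring R] [AddCommGroup M] [Module Rᵐᵒᵖ M] [AddCommGroup N]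
  [Module R N] [AddCommGroup M'] [Module Rᵐᵒᵖ M'] [AddCommGroup N'] [Module R N']

theorem exists_eq_sum_tmul (z : BalTensor R M N) :
    ∃ (k : ℕ) (m : Fin k → M) (n : Fin k → N), z = ∑ i, tmul R (m i) (n i) := by
  induction z using BalTensor.induction with
  | zero => exact ⟨0, fun _ => 0, fun _ => 0, by simp⟩
  | tmul m n => exact ⟨1, fun _ => m, fun _ => n, by simp⟩
  | add x y hx hy =>
    obtain ⟨k, m, n, rfl⟩ := hx
    obtain ⟨k', m', n', rfl⟩ := hy
    exact ⟨k + k', Fin.append m m', Fin.append n n', by simp [Fin.sum_univ_add]⟩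

theorem map_sub_left (f f' : M →ₗ[Rᵐᵒᵖ] M') (g : N →ₗ[R] N') (z : BalTensor R M N) :
    map (f - f') g z = map f g z - map f' g z :=
  eq_sub_of_add_eq (by rw [← map_add_left, sub_add_cancel])

theorem map_id_mem_range {L : Type*} [AddCommGroup L] [Module Rᵐᵒᵖ L] {f : L →ₗ[Rᵐᵒᵖ] M'}
    {h : M →ₗ[Rᵐᵒᵖ] M'} (hfh : LinearMap.range h ≤ LinearMap.range f) (z : BalTensor R M N) :
    map h LinearMap.id z ∈ (map f (LinearMap.id : N →ₗ[R] N)).range := by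
  induction z using BalTensor.induction with
  | zero => exact zero_mem _
  | tmul m n =>
    obtain ⟨l, hl⟩ := hfh (LinearMap.mem_range_self h m)
    exact ⟨tmul R l n, by rw [map_tmul, map_tmul, hl]⟩
  | add x y hx hy =>
    rw [map_add]
    exact add_mem hx hy

theorem assoc_map_rTensor {S Q : Type*} [Ring S] [Module Sᵐᵒᵖ N] [SMulCommClass R Sᵐᵒᵖ N]
    [AddCommGroup Q] [Module S Q] (f : M →ₗ[Rᵐᵒᵖ] M') (z : BalTensor S (BalTensor R M N) Q) :
    assoc (map (rTensor (S := S) N f) LinearMap.id z) = map f LinearMap.id (assoc z) := by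
  induction z using BalTensor.induction with
  | zero => simp only [map_zero]
  | add x y hx hy => simp only [map_add, hx, hy]
  | tmul w q =>
    induction w using BalTensor.induction with
    | zero => simp only [zero_tmul, map_zero]
    | tmul m n => rfl
    | add x y hx hy => simp only [add_tmul, map_add, hx, hy]

end BalTensor

namespace MoritaContext

variable {T S P Q : Type*} [Ring T] [Ring S] [AddCommGroup P] [AddCommGroup Q]
  [Module T P] [Module Sᵐᵒᵖ P] [SMulCommClass T Sᵐᵒᵖ P]
  [Module S Q] [Module Tᵐᵒᵖ Q] [SMulCommClass S Tᵐᵒᵖ Q]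

/-- The Morita context with the roles of the two rings exchanged. -/
def symm (m : MoritaContext T S P Q) : MoritaContext S T Q P where
  toS := m.toT
  toT := m.toS
  toS_smul := m.toT_smul
  toS_op_smul := m.toT_op_smul
  toT_smul := m.toS_smul
  toT_op_smul := m.toS_op_smul
  assoc_P := m.assoc_Q
  assoc_Q := m.assoc_P

variable (m : MoritaContext T S P Q)

section Contract

variable {N N' N'' : Type*} [AddCommGroup N] [Module Tᵐᵒᵖ N] [AddCommGroup N'] [Module Tᵐᵒᵖ N']
  [AddCommGroup N''] [Module Tᵐᵒᵖ N'']

/-- The contraction `N ⊗_T P → Hom_T(Q, N)`, `n ⊗ p ↦ (q ↦ n · (p q))`, along the connecting map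
`P ⊗_S Q → T`. It is how an element of `Q ⊗_T P` over `1 ∈ S` inverts maps out of `N ⊗_T P`. -/
def contract : BalTensor T N P →+ (Q →ₗ[Tᵐᵒᵖ] N) :=
  lift'
    (fun n p =>
      { toFun := fun q => op (m.toT (tmul S p q)) • n
        map_add' := fun q q' => by rw [tmul_add, map_add, op_add, add_smul]
        map_smul' := fun t q => by
          rw [← right_smul_tmul, m.toT_op_smul, RingHom.id_apply, smul_smul]
          rfl })
    (fun _ _ _ => LinearMap.ext fun _ => smul_add _ _ _)
    (fun _ _ _ => LinearMap.ext fun _ => by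
      simp only [LinearMap.coe_mk, AddHom.coe_mk, LinearMap.add_apply, add_tmul, map_add, op_add,
        add_smul])
    (fun n t p => LinearMap.ext fun q => by
      simp only [LinearMap.coe_mk, AddHom.coe_mk, ← left_smul_tmul, m.toT_smul, smul_eq_mul,
        op_mul, mul_smul])

theorem contract_tmul_apply (n : N) (p : P) (q : Q) :
    m.contract (tmul T n p) q = op (m.toT (tmul S p q)) • n :=
  rfl

theorem contract_map (f : N →ₗ[Tᵐᵒᵖ] N') (z : BalTensor T N P) :
    m.contract (map f LinearMap.id z) = f ∘ₗ m.contract z := by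
  induction z using BalTensor.induction with
  | zero => simp only [map_zero, LinearMap.comp_zero]
  | tmul n p => exact LinearMap.ext fun q => (map_smul f _ n).symm
  | add x y hx hy => simp only [map_add, hx, hy, LinearMap.comp_add]

theorem contract_apply_eq_toS_smul (z : BalTensor T Q P) (q : Q) :
    m.contract z q = m.toS z • q := by
  induction z using BalTensor.induction with
  | zero => simp only [map_zero, LinearMap.zero_apply, zero_smul]
  | tmul q' p => rw [contract_tmul_apply, m.assoc_Q]
  | add x y hx hy => simp only [map_add, LinearMap.add_apply, hx, hy, add_smul]

theorem map_contract (z : BalTensor T N P) (w : BalTensor T Q P) :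
    map (m.contract z) LinearMap.id w = op (m.toS w) • z := by
  induction w using BalTensor.induction with
  | zero => simp only [map_zero, op_zero, zero_smul]
  | add x y hx hy => simp only [map_add, op_add, add_smul, hx, hy]
  | tmul q p' =>
    induction z using BalTensor.induction with
    | zero => simp only [map_zero, map_zero_left, smul_zero]
    | add x y hx hy => simp only [map_add, map_add_left, smul_add, hx, hy]
    | tmul n p =>
      rw [map_tmul, contract_tmul_apply, smul_tmul, m.assoc_P, right_smul_tmul, LinearMap.id_apply]

variable {m}

theorem eq_map_contract {w : BalTensor T Q P} (hw : m.toS w = 1) (z : BalTensor T N P) :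
    z = map (m.contract z) LinearMap.id w := by
  rw [m.map_contract, hw, op_one, one_smul]

theorem contract_injective (hS : Function.Surjective m.toS) :
    Function.Injective (m.contract (N := N)) := by
  obtain ⟨w, hw⟩ := hS 1
  intro z z' h
  rw [eq_map_contract hw z, h, ← eq_map_contract hw z']

theorem toS_injective (hS : Function.Surjective m.toS) : Function.Injective m.toS :=
  fun z z' h => contract_injective hS <| LinearMap.ext fun q => by
    rw [contract_apply_eq_toS_smul, contract_apply_eq_toS_smul, h]

theorem isStrict_of_surjective (hS : Function.Surjective m.toS) (hT : Function.Surjective m.toT) :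
    m.IsStrict :=
  ⟨⟨toS_injective hS, hS⟩, m.symm.toS_injective hT, hT⟩

theorem exact_map (hS : Function.Surjective m.toS) {f : N →ₗ[Tᵐᵒᵖ] N'} {g : N' →ₗ[Tᵐᵒᵖ] N''}
    (hfg : Function.Exact f g) :
    Function.Exact (map f (LinearMap.id : P →ₗ[T] P)) (map g (LinearMap.id : P →ₗ[T] P)) := by
  obtain ⟨w, hw⟩ := hS 1
  refine fun z => ⟨fun hz => ?_, ?_⟩
  · have range_le : LinearMap.range (m.contract z) ≤ LinearMap.range f := by
      rw [← hfg.linearMap_ker_eq, LinearMap.range_le_ker_iff, ← contract_map, hz, map_zero]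
    rw [eq_map_contract hw z]
    exact map_id_mem_range range_le w
  · rintro ⟨z, rfl⟩
    rw [← map_comp, hfg.linearMap_comp_eq_zero, map_zero_left]

theorem mem_range_of_tmul_mem_range (hT : Function.Surjective m.toT) {f : N →ₗ[Tᵐᵒᵖ] N'} {n : N'}
    (hn : ∀ p, tmul T n p ∈ (map f (LinearMap.id : P →ₗ[T] P)).range) :
    n ∈ LinearMap.range f := by
  suffices h : ∀ v, op (m.toT v) • n ∈ LinearMap.range f by
    obtain ⟨v, hv⟩ := hT 1
    simpa only [hv, op_one, one_smul] using h v
  intro v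
  induction v using BalTensor.induction with
  | zero => rw [map_zero, op_zero, zero_smul]; exact zero_mem _
  | add x y hx hy => rw [map_add, op_add, add_smul]; exact add_mem hx hy
  | tmul p q =>
    obtain ⟨z, hz⟩ := hn p
    exact ⟨m.contract z q, by rw [← contract_tmul_apply, ← hz, contract_map, LinearMap.comp_apply]⟩

theorem eq_zero_of_tmul_eq_zero (hT : Function.Surjective m.toT) {n : N}
    (hn : ∀ p : P, tmul T n p = 0) : n = 0 := by
  obtain ⟨_, rfl⟩ := mem_range_of_tmul_mem_range hT (f := (0 : N →ₗ[Tᵐᵒᵖ] N))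
    fun p => (hn p).symm ▸ zero_mem _
  rfl

theorem exact_of_exact_map (hT : Function.Surjective m.toT) {f : N →ₗ[Tᵐᵒᵖ] N'}
    {g : N' →ₗ[Tᵐᵒᵖ] N''}
    (hfg : Function.Exact (map f (LinearMap.id : P →ₗ[T] P)) (map g (LinearMap.id : P →ₗ[T] P))) :
    Function.Exact f g := by
  refine fun n => ⟨fun hn => mem_range_of_tmul_mem_range hT fun p => (hfg _).1 ?_, ?_⟩
  · rw [map_tmul, hn, zero_tmul]
  · rintro ⟨n, rfl⟩
    exact eq_zero_of_tmul_eq_zero hT fun p => hfg.apply_apply_eq_zero (tmul T n p)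

end Contract

section Quotient

/-- The image of the connecting map `P ⊗_S Q → T`, as a right ideal. -/
def rangeToT : Submodule Tᵐᵒᵖ T where
  __ := m.toT.range
  smul_mem' := by
    rintro t _ ⟨z, rfl⟩
    exact ⟨t • z, m.toT_op_smul t z⟩

variable {m}

theorem contract_quotient_rangeToT (z : BalTensor T (T ⧸ m.rangeToT) P) : m.contract z = 0 := by
  induction z using BalTensor.induction with
  | zero => exact map_zero _
  | add x y hx hy => rw [map_add, hx, hy, add_zero]
  | tmul n p =>
    obtain ⟨t, rfl⟩ := Submodule.Quotient.mk_surjective _ n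
    exact LinearMap.ext fun q =>
      (Submodule.Quotient.mk_eq_zero _).2 ⟨t • tmul S p q, m.toT_smul t _⟩

theorem toT_surjective_of_tmul_quotient (hS : Function.Surjective m.toS)
    (h : ∀ n : T ⧸ m.rangeToT, (∀ p : P, tmul T n p = 0) → n = 0) :
    Function.Surjective m.toT := fun t =>
  (Submodule.Quotient.mk_eq_zero m.rangeToT).1 <| h _ fun p => contract_injective hS <| by
    rw [contract_quotient_rangeToT, map_zero]

end Quotient

theorem IsStrict.isFaithfullyFlat {T P : Type u} {S Q : Type*} [Ring T] [Ring S] [AddCommGroup P]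
    [AddCommGroup Q] [Module T P] [Module Sᵐᵒᵖ P] [SMulCommClass T Sᵐᵒᵖ P]
    [Module S Q] [Module Tᵐᵒᵖ Q] [SMulCommClass S Tᵐᵒᵖ Q] {m : MoritaContext T S P Q}
    (hm : m.IsStrict) : IsFaithfullyFlat T P := by
  intro _ _ _ _ _ _ _ _ _ f g
  exact ⟨exact_map hm.1.2, exact_of_exact_map hm.2.2⟩

end MoritaContext

section Dual

variable {A C : Type*} [Ring A] [AddCommGroup C] [Module A C]
  {M M' : Type*} [AddCommGroup M] [Module Aᵐᵒᵖ M] [AddCommGroup M'] [Module Aᵐᵒᵖ M']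
  {N N' : Type*} [AddCommGroup N] [Module A N] [AddCommGroup N'] [Module A N']

theorem actMap_map (f : C →ₗ[A] A) (φ : M →ₗ[Aᵐᵒᵖ] M') (w : BalTensor A M C) :
    actMap f M' (map φ LinearMap.id w) = φ (actMap f M w) := by
  induction w using BalTensor.induction with
  | zero => simp only [map_zero]
  | tmul m c => exact (map_smul φ _ m).symm
  | add x y hx hy => simp only [map_add, hx, hy]

theorem actMap_add_left (f g : C →ₗ[A] A) (w : BalTensor A M C) :
    actMap (f + g) M w = actMap f M w + actMap g M w := by
  induction w using BalTensor.induction with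
  | zero => simp only [map_zero, add_zero]
  | tmul m c => simp only [actMap_tmul, LinearMap.add_apply, op_add, add_smul]
  | add x y hx hy => simp only [map_add, hx, hy, add_add_add_comm]

/-- The natural map `*C ⊗_A N → Hom_A(C, N)`, `f ⊗ n ↦ (c ↦ f(c) n)`. -/
def dualHom : BalTensor A (LeftDual A C) N →+ (C →ₗ[A] N) :=
  lift' (fun f n => f.toLin.smulRight n)
    (fun _ _ _ => LinearMap.ext fun _ => add_smul _ _ _)
    (fun _ _ _ => LinearMap.ext fun _ => smul_add _ _ _)
    (fun _ _ _ => LinearMap.ext fun _ => mul_smul _ _ _)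

theorem dualHom_map (g : N →ₗ[A] N') (z : BalTensor A (LeftDual A C) N) :
    dualHom (map LinearMap.id g z) = g ∘ₗ dualHom z := by
  induction z using BalTensor.induction with
  | zero => simp only [map_zero, LinearMap.comp_zero]
  | tmul f n => exact LinearMap.ext fun c => (map_smul g (f c) n).symm
  | add x y hx hy => simp only [map_add, hx, hy, LinearMap.comp_add]

theorem actMap_leftDual (f : C →ₗ[A] A) (z : BalTensor A (LeftDual A C) C) :
    (actMap f (LeftDual A C) z).toLin = f ∘ₗ dualHom z := by
  induction z using BalTensor.induction with
  | zero => simp only [map_zero, LinearMap.comp_zero]; rfl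
  | tmul g d => exact LinearMap.ext fun c => (map_smul f (g c) d).symm
  | add x y hx hy =>
    rw [map_add, map_add, LinearMap.comp_add, ← hx, ← hy]
    rfl

variable (A C N) in
/-- Evaluation of `*C ⊗_A N → Hom_A(C, N)` at `c`, as a map of right `S`-modules. -/
def dualEval {S : Type*} [Ring S] [Module Sᵐᵒᵖ N] [SMulCommClass A Sᵐᵒᵖ N] (c : C) :
    BalTensor A (LeftDual A C) N →ₗ[Sᵐᵒᵖ] N where
  toFun z := dualHom z c
  map_add' z z' := by rw [map_add, LinearMap.add_apply]
  map_smul' s z := LinearMap.congr_fun (dualHom_map (rmul A s) z) c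

theorem dualHom_assoc_apply {S Q : Type*} [Ring S] [Module Sᵐᵒᵖ N] [SMulCommClass A Sᵐᵒᵖ N]
    [AddCommGroup Q] [Module S Q] (c : C)
    (z : BalTensor S (BalTensor A (LeftDual A C) N) Q) :
    dualHom (assoc z) c = map (dualEval A C N c) LinearMap.id z := by
  induction z using BalTensor.induction with
  | zero => simp only [map_zero, LinearMap.zero_apply]
  | add x y hx hy => simp only [map_add, LinearMap.add_apply, hx, hy]
  | tmul w q =>
    induction w using BalTensor.induction with
    | zero => simp only [zero_tmul, map_zero, LinearMap.zero_apply]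
    | tmul f n => rfl
    | add x y hx hy => simp only [add_tmul, map_add, LinearMap.add_apply, hx, hy]

/-- An element `∑ fᵢ ⊗ bᵢ` of `*C ⊗_A C` is a dual basis of the left `A`-module `C` if
`c = ∑ fᵢ(c) bᵢ` for all `c`. -/
def IsDualBasis (e : BalTensor A (LeftDual A C) C) : Prop :=
  dualHom e = LinearMap.id

variable (A C) in
theorem exists_isDualBasis_iff :
    (∃ e : BalTensor A (LeftDual A C) C, IsDualBasis e) ↔
      Module.Finite A C ∧ Module.Projective A C := by
  constructor
  · rintro ⟨e, he⟩
    obtain ⟨k, f, b, rfl⟩ := exists_eq_sum_tmul e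
    have split : Fintype.linearCombination A b ∘ₗ LinearMap.pi (fun i => (f i).toLin) =
        LinearMap.id := by
      rw [← he]
      ext c
      simp only [map_sum, LinearMap.sum_apply]
      rfl
    exact ⟨.of_surjective (Fintype.linearCombination A b) fun c => ⟨_, LinearMap.congr_fun split c⟩,
      .of_split _ _ split⟩
  · rintro ⟨_, _⟩
    obtain ⟨k, s, r, -, -, hsr⟩ := Module.Finite.exists_comp_eq_id_of_projective A C
    refine ⟨∑ i, tmul A (LinearMap.proj i ∘ₗ r : LeftDual A C) (s (Pi.single i 1)),
      LinearMap.ext fun c => ?_⟩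
    rw [map_sum, LinearMap.sum_apply, ← hsr, LinearMap.comp_apply,
      LinearMap.pi_apply_eq_sum_univ s (r c)]
    refine Finset.sum_congr rfl fun i _ => congrArg (fun v => r c i • s v) (funext fun j => ?_)
    simp only [Pi.single_apply, eq_comm]

namespace IsDualBasis

variable {e : BalTensor A (LeftDual A C) C}

theorem actMap_eq_self (he : IsDualBasis e) (f : LeftDual A C) :
    actMap f.toLin (LeftDual A C) e = f :=
  (actMap_leftDual f.toLin e).trans (by rw [he, LinearMap.comp_id]; rfl)

theorem map_dualHom (he : IsDualBasis e) (z : BalTensor A (LeftDual A C) N) :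
    map LinearMap.id (dualHom z) e = z := by
  induction z using BalTensor.induction with
  | zero => rw [map_zero, map_zero_right]
  | add x y hx hy => rw [map_add, map_add_right, hx, hy]
  | tmul f n =>
    conv_rhs => rw [← he.actMap_eq_self f]
    clear he
    induction e using BalTensor.induction with
    | zero => simp only [map_zero, zero_tmul]
    | tmul g d => exact (smul_tmul g (f d) n).symm
    | add x y hx hy => simp only [map_add, add_tmul, hx, hy]

theorem dualHom_injective (he : IsDualBasis e) :
    Function.Injective (dualHom (A := A) (C := C) (N := N)) := fun z z' h => by
  rw [← he.map_dualHom z, h, he.map_dualHom]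

end IsDualBasis

end Dual

section StrictContext

variable {A C : Type*} [Ring A] [AddCommGroup C] [Module A C] [Module Aᵐᵒᵖ C]
  [SMulCommClass A Aᵐᵒᵖ C] [Coring A C]

/-- This makes `N ⊗_A C`, for a right `A`-module `N`, a right `*C`-module through the action
`c f = c⁽¹⁾ f(c⁽²⁾)` on `C`. -/
instance : SMulCommClass A (LeftDual A C)ᵐᵒᵖ C where
  smul_comm a f c := (comoduleAct_smul f.unop a c).symm

variable {X : Type*} [AddCommGroup X] [Module Aᵐᵒᵖ X] {N : Type*} [AddCommGroup N] [Module Aᵐᵒᵖ N]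

theorem actLin_zero (q : X →ₗ[Aᵐᵒᵖ] LeftDual A C) : actLin q (0 : BalTensor A N C) = 0 :=
  LinearMap.ext fun y => map_zero (actMap (q y).toLin N)

theorem actLin_add (q : X →ₗ[Aᵐᵒᵖ] LeftDual A C) (w w' : BalTensor A N C) :
    actLin q (w + w') = actLin q w + actLin q w' :=
  LinearMap.ext fun y => map_add (actMap (q y).toLin N) w w'

theorem qMap_eq_dualHom_map (q : X →ₗ[Aᵐᵒᵖ] LeftDual A C) (c : C) (z : BalTensor A X C) :
    qMap q c z = dualHom (map q LinearMap.id z) c := by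
  induction z using BalTensor.induction with
  | zero => simp only [map_zero, LinearMap.zero_apply]
  | tmul y d => rfl
  | add x y hx hy => simp only [map_add, LinearMap.add_apply, hx, hy]

theorem map_actLin (q : X →ₗ[Aᵐᵒᵖ] LeftDual A C) (w : BalTensor A N C) (z : BalTensor A X C) :
    map (actLin q w) LinearMap.id z = map LinearMap.id (dualHom (map q LinearMap.id z)) w := by
  induction z using BalTensor.induction with
  | zero => simp only [map_zero, map_zero_right]
  | add x y hx hy => simp only [map_add, map_add_right, hx, hy]
  | tmul y d =>
    induction w using BalTensor.induction with
    | zero => simp only [actLin_zero, map_zero, map_zero_left]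
    | tmul n c => exact smul_tmul n (q y c) d
    | add u v hu hv => simp only [actLin_add, map_add_left, map_add, hu, hv]

theorem actLin_mem_range_dualHom (q : X →ₗ[Aᵐᵒᵖ] LeftDual A C) (w : BalTensor A N C) :
    actLin q w ∈ (dualHom (A := Aᵐᵒᵖ) (C := X) (N := N)).range := by
  induction w using BalTensor.induction with
  | zero => exact actLin_zero (N := N) q ▸ zero_mem _
  | add u v hu hv => exact actLin_add q u v ▸ add_mem hu hv
  | tmul n c =>
    let ψ : X →ₗ[Aᵐᵒᵖ] Aᵐᵒᵖ :=
      { toFun := fun y => op (q y c)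
        map_add' := fun y y' => by rw [_root_.map_add, LeftDual.add_apply, op_add]
        map_smul' := fun a y => by rw [_root_.map_smul, LeftDual.op_smul_apply, op_mul]; rfl }
    exact ⟨tmul Aᵐᵒᵖ (ψ : LeftDual Aᵐᵒᵖ X) n, rfl⟩

variable [RightComodule A C X]

theorem mem_moritaQ_iff_dualHom_map_coact (q : X →ₗ[Aᵐᵒᵖ] LeftDual A C) :
    q ∈ moritaQ A C X ↔
      ∀ x, dualHom (map q LinearMap.id (coact A C x)) = comoduleActL (q x) := by
  simp only [LinearMap.ext_iff, ← qMap_eq_dualHom_map]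
  rfl

variable (A C X N) in
/-- The map `N ⊗_A C → Hom_T(Q, Hom_A(X, N))` sending `n ⊗ c` to `q ↦ (y ↦ n q(y)(c))`. -/
def actHom : BalTensor A N C →+ (moritaQ A C X →ₗ[(comodEnd A C X)ᵐᵒᵖ] (X →ₗ[Aᵐᵒᵖ] N)) where
  toFun w :=
    { toFun := fun q => actLin q.1 w
      map_add' := fun q q' => LinearMap.ext fun y => actMap_add_left (q.1 y).toLin (q'.1 y).toLin w
      map_smul' := fun _ _ => rfl }
  map_zero' := LinearMap.ext fun q => actLin_zero q.1
  map_add' w w' := LinearMap.ext fun q => actLin_add q.1 w w'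

theorem can_map_actHom (w : BalTensor A N C) (z : BalTensor (comodEnd A C X) (moritaQ A C X) X) :
    can A C X N (map (actHom A C X N w) LinearMap.id z) = op ((moritaContext A C X).toS z) • w := by
  induction z using BalTensor.induction with
  | zero => simp only [_root_.map_zero, op_zero, zero_smul]
  | tmul q x =>
    refine (map_actLin q.1 w (coact A C x)).trans ?_
    rw [(mem_moritaQ_iff_dualHom_map_coact q.1).1 q.2 x]
    rfl
  | add x y hx hy => simp only [_root_.map_add, op_add, add_smul, hx, hy]

theorem actHom_can (z : BalTensor (comodEnd A C X) (X →ₗ[Aᵐᵒᵖ] N) X) :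
    actHom A C X N (can A C X N z) = (moritaContext A C X).contract z := by
  induction z using BalTensor.induction with
  | zero => simp only [_root_.map_zero]
  | tmul φ x =>
    exact LinearMap.ext fun q => LinearMap.ext fun y => actMap_map (q.1 y).toLin φ (coact A C x)
  | add x y hx hy => simp only [_root_.map_add, hx, hy]

theorem can_bijective (hS : Function.Surjective (moritaContext A C X).toS) :
    Function.Bijective (can A C X N) := by
  constructor
  · refine Function.Injective.of_comp (f := actHom A C X N) ?_
    simpa only [Function.comp_def, actHom_can] using MoritaContext.contract_injective hS
  · intro w
    obtain ⟨z, hz⟩ := hS 1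
    exact ⟨map (actHom A C X N w) LinearMap.id z, by rw [can_map_actHom, hz, op_one, one_smul]⟩

variable (A C X) in
/-- The inclusion of `Q` in `Hom_A(X, *C)`, as a map of right `T`-modules. -/
def moritaQIncl :
    moritaQ A C X →ₗ[(comodEnd A C X)ᵐᵒᵖ] (X →ₗ[Aᵐᵒᵖ] LeftDual A C) where
  __ := (moritaQ A C X).subtype
  map_smul' _ _ := rfl

theorem dualHom_can_moritaQIncl
    (z : BalTensor (comodEnd A C X) (moritaQ A C X) X) :
    dualHom (can A C X _ (map (moritaQIncl A C X) LinearMap.id z)) =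
      comoduleActL ((moritaContext A C X).toS z) := by
  induction z using BalTensor.induction with
  | zero =>
    simp only [_root_.map_zero]
    exact LinearMap.ext fun c => (comoduleAct_zero C c).symm
  | tmul q x => exact (mem_moritaQ_iff_dualHom_map_coact q.1).1 q.2 x
  | add x y hx hy =>
    simp only [_root_.map_add, hx, hy]
    exact LinearMap.ext fun c => (comoduleAct_add C _ _ c).symm

theorem exists_isDualBasis_of_toS_surjective
    (hS : Function.Surjective (moritaContext A C X).toS) :
    ∃ e : BalTensor A (LeftDual A C) C, IsDualBasis e := by
  obtain ⟨z, hz⟩ := hS 1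
  exact ⟨_, (dualHom_can_moritaQIncl z).trans (by rw [hz]; exact LinearMap.ext (comoduleAct_one C))⟩

theorem toT_mem_range_dualHom (v : BalTensor (LeftDual A C) X (moritaQ A C X)) :
    ((moritaContext A C X).toT v).1 ∈ (dualHom (A := Aᵐᵒᵖ) (C := X) (N := X)).range := by
  induction v using BalTensor.induction with
  | zero => rw [_root_.map_zero]; exact zero_mem _
  | tmul x q => exact actLin_mem_range_dualHom q.1 (coact A C x)
  | add u v hu hv => rw [_root_.map_add]; exact add_mem hu hv

theorem finite_and_projective_of_toT_surjective
    (hT : Function.Surjective (moritaContext A C X).toT) :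
    Module.Finite Aᵐᵒᵖ X ∧ Module.Projective Aᵐᵒᵖ X := by
  obtain ⟨v, hv⟩ := hT 1
  obtain ⟨e, he⟩ := toT_mem_range_dualHom v
  exact (exists_isDualBasis_iff Aᵐᵒᵖ X).1 ⟨e, he.trans (by rw [hv]; rfl)⟩

end StrictContext

section UnitCounit

variable {A : Type*} {C : Type*} [Ring A] [AddCommGroup C] [Module A C] [Module Aᵐᵒᵖ C]
  [SMulCommClass A Aᵐᵒᵖ C] [Coring A C]
  {X : Type*} [AddCommGroup X] [Module Aᵐᵒᵖ X] [RightComodule A C X]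

variable (A C X) in
/-- The unit `N → Hom^C(X, N ⊗_T X)`, `n ↦ (x ↦ n ⊗ x)`. -/
def tensorUnit (N : Type*) [AddCommGroup N] [Module (comodEnd A C X)ᵐᵒᵖ N] :
    N →ₗ[(comodEnd A C X)ᵐᵒᵖ] comoduleHom A C X (BalTensor (comodEnd A C X) N X) where
  toFun n := ⟨tmulLin A C X n, fun _ => rfl⟩
  map_add' n n' := Subtype.ext (tmulLin_add n n')
  map_smul' t n := Subtype.ext (tmulLin_smul n t.unop)

variable (A C X) in
/-- The counit `Hom^C(X, M) ⊗_T X → M`, `φ ⊗ x ↦ φ(x)`. -/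
def tensorCounit (M : Type*) [AddCommGroup M] [Module Aᵐᵒᵖ M] [RightComodule A C M] :
    BalTensor (comodEnd A C X) (comoduleHom A C X M) X →ₗ[Aᵐᵒᵖ] M where
  __ := lift' (fun (φ : comoduleHom A C X M) (x : X) => φ.1 x) (fun _ _ _ => rfl)
    (fun φ _ _ => _root_.map_add φ.1 _ _) (fun _ _ _ => rfl)
  map_smul' := map_right_smul (lift' _ _ _ _) fun a φ x => _root_.map_smul φ.1 a x

theorem tensorCounit_mem (M : Type*) [AddCommGroup M] [Module Aᵐᵒᵖ M] [RightComodule A C M] :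
    tensorCounit A C X M ∈
      comoduleHom A C (BalTensor (comodEnd A C X) (comoduleHom A C X M) X) M := by
  intro z
  induction z using BalTensor.induction with
  | zero => simp only [_root_.map_zero]
  | add x y hx hy => simp only [_root_.map_add, hx, hy]
  | tmul φ x =>
    change coact A C (φ.1 x) = map (tensorCounit A C X M) LinearMap.id
      (map (tmulLin A C X φ) LinearMap.id (coact A C x))
    rw [φ.2 x, ← map_comp]
    rfl

theorem tensorCounit_map_tensorUnit {N : Type*} [AddCommGroup N] [Module (comodEnd A C X)ᵐᵒᵖ N]
    (z : BalTensor (comodEnd A C X) N X) :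
    tensorCounit A C X _ (map (tensorUnit A C X N) LinearMap.id z) = z := by
  induction z using BalTensor.induction with
  | zero => simp only [_root_.map_zero]
  | add x y hx hy => simp only [_root_.map_add, hx, hy]
  | tmul n x => rfl

end UnitCounit

section Adjunction

open CategoryTheory

variable (A C : Type u) [Ring A] [AddCommGroup C] [Module A C] [Module Aᵐᵒᵖ C]
  [SMulCommClass A Aᵐᵒᵖ C] [Coring A C]
  (X : Type u) [AddCommGroup X] [Module Aᵐᵒᵖ X] [RightComodule A C X]

/-- The functor `- ⊗_T X` is left adjoint to `Hom^C(X, -)`. -/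
def tensorHomAdjunction : tensorFunctor A C X ⊣ homFunctor A C X :=
  Adjunction.mkOfUnitCounit
    { unit := { app := fun N => ModuleCat.ofHom (tensorUnit A C X N)
                naturality := fun _ _ _ => rfl }
      counit :=
        { app := fun M => ⟨tensorCounit A C X M.carrier, tensorCounit_mem M.carrier⟩
          naturality := fun M M' f => Subtype.ext <| LinearMap.ext fun z =>
            hom_ext_apply
              (f := (tensorCounit A C X M'.carrier).toAddMonoidHom.comp
                (map ((homFunctor A C X).map f).hom LinearMap.id))
              (g := f.1.toAddMonoidHom.comp (tensorCounit A C X M.carrier).toAddMonoidHom)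
              (fun _ _ => rfl) z }
      left_triangle := by
        ext N
        exact Subtype.ext (LinearMap.ext tensorCounit_map_tensorUnit)
      right_triangle := rfl }

variable {A C} in
theorem ComodCat.isIso_iff_bijective {M N : ComodCat A C} (f : M ⟶ N) :
    IsIso f ↔ Function.Bijective f.1 := by
  refine ⟨fun _ => ?_, fun hf => ?_⟩
  · refine Function.bijective_iff_has_inverse.2 ⟨(inv f).1, fun m => ?_, fun n => ?_⟩
    · exact congrArg (fun g : M ⟶ M => g.1 m) (IsIso.hom_inv_id f)
    · exact congrArg (fun g : N ⟶ N => g.1 n) (IsIso.inv_hom_id f)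
  · let e := LinearEquiv.ofBijective f.1 hf
    refine ⟨⟨e.symm.toLinearMap, fun n => ?_⟩, Subtype.ext (LinearMap.ext e.symm_apply_apply),
      Subtype.ext (LinearMap.ext e.apply_symm_apply)⟩
    obtain ⟨m, rfl⟩ := e.surjective n
    have symm_comp : e.symm.toLinearMap ∘ₗ f.1 = LinearMap.id := LinearMap.ext e.symm_apply_apply
    calc coact A C (e.symm (e m))
        = map (e.symm.toLinearMap ∘ₗ f.1) LinearMap.id (coact A C m) := by
          rw [e.symm_apply_apply, symm_comp, map_id]
      _ = map e.symm.toLinearMap LinearMap.id (coact A C (f.1 m)) := by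
          rw [f.2 m, ← map_comp, LinearMap.id_comp]

theorem exists_equivalence_iff :
    (∃ e : ModuleCat.{u} (comodEnd A C X)ᵐᵒᵖ ≌ ComodCat A C,
      e.functor = tensorFunctor A C X ∧ e.inverse = homFunctor A C X) ↔
    (∀ (N : Type u) [AddCommGroup N] [Module (comodEnd A C X)ᵐᵒᵖ N],
      Function.Bijective (tensorUnit A C X N)) ∧
    (∀ (M : Type u) [AddCommGroup M] [Module Aᵐᵒᵖ M] [RightComodule A C M],
      Function.Bijective (tensorCounit A C X M)) := by
  constructor
  · rintro ⟨e, functor_eq, inverse_eq⟩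
    have : (tensorFunctor A C X).IsEquivalence := functor_eq ▸ inferInstance
    have : (homFunctor A C X).IsEquivalence := inverse_eq ▸ inferInstance
    refine ⟨fun N _ _ => ?_, fun M _ _ _ => ?_⟩
    · exact (ConcreteCategory.isIso_iff_bijective
        ((tensorHomAdjunction A C X).unit.app (ModuleCat.of _ N))).1 inferInstance
    · exact (ComodCat.isIso_iff_bijective
        ((tensorHomAdjunction A C X).counit.app ⟨M⟩)).1 inferInstance
  · rintro ⟨unit_bijective, counit_bijective⟩
    have isIso_unit (N) : IsIso ((tensorHomAdjunction A C X).unit.app N) :=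
      (ConcreteCategory.isIso_iff_bijective _).2 (unit_bijective N)
    have isIso_counit (M) : IsIso ((tensorHomAdjunction A C X).counit.app M) :=
      (ComodCat.isIso_iff_bijective _).2 (counit_bijective M.carrier)
    exact ⟨(tensorHomAdjunction A C X).toEquivalence, rfl, rfl⟩

end Adjunction

section DualComodule

variable {A C : Type*} [Ring A] [AddCommGroup C] [Module A C] [Module Aᵐᵒᵖ C]
  [SMulCommClass A Aᵐᵒᵖ C] [Coring A C]

/-- The coaction `f ↦ ∑ eᵢ ⊗ bᵢ⁽¹⁾ f(bᵢ⁽²⁾)` on `*C` attached to an element `e = ∑ eᵢ ⊗ bᵢ` of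
`*C ⊗_A C`. It is a comodule structure if `e` is a dual basis. -/
def dualCoact (e : BalTensor A (LeftDual A C) C) :
    LeftDual A C →ₗ[Aᵐᵒᵖ] BalTensor A (LeftDual A C) C where
  toFun f := op f • e
  map_add' f g := by rw [op_add, add_smul]
  map_smul' a f := by
    induction e using BalTensor.induction with
    | zero => simp only [smul_zero]
    | tmul φ c => exact congrArg (tmul A φ) (comoduleAct_op_smul C a f c)
    | add x y hx hy => simp only [smul_add, hx, hy]

namespace IsDualBasis

variable {e : BalTensor A (LeftDual A C) C}

theorem dualHom_dualCoact (he : IsDualBasis e) (f : LeftDual A C) :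
    dualHom (dualCoact e f) = comoduleActL f :=
  (dualHom_map (comoduleActL f) e).trans (by rw [he, LinearMap.comp_id])

theorem dualEval_comp_dualCoact (he : IsDualBasis e) (c : C) :
    dualEval A C C c ∘ₗ dualCoact e = actLin LinearMap.id (Coring.comul c) :=
  LinearMap.ext fun f => LinearMap.congr_fun (he.dualHom_dualCoact f) c

theorem assoc_map_dualCoact (he : IsDualBasis e) (f : LeftDual A C) :
    assoc (map (dualCoact e) LinearMap.id (dualCoact e f)) =
      map LinearMap.id (Coring.comulL A C) (dualCoact e f) := by
  refine he.dualHom_injective (LinearMap.ext fun c => ?_)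
  calc dualHom (assoc (map (dualCoact e) LinearMap.id (dualCoact e f))) c
      = map (dualEval A C C c ∘ₗ dualCoact e) LinearMap.id (dualCoact e f) := by
        rw [dualHom_assoc_apply, ← map_comp, LinearMap.id_comp]
    _ = map LinearMap.id (comoduleActL f) (Coring.comul c) := by
        rw [he.dualEval_comp_dualCoact, map_actLin, map_id, he.dualHom_dualCoact]
    _ = Coring.comul (comoduleAct C f c) := (coact_comoduleAct C f c).symm
    _ = dualHom (map LinearMap.id (Coring.comulL A C) (dualCoact e f)) c := by
        rw [dualHom_map, he.dualHom_dualCoact]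
        rfl

theorem actMap_counit_dualCoact (he : IsDualBasis e) (f : LeftDual A C) :
    actMap (Coring.counit : C →ₗ[A] A) (LeftDual A C) (dualCoact e f) = f :=
  (actMap_leftDual _ _).trans (by rw [he.dualHom_dualCoact]; exact mul_one f)

/-- The comodule structure on `*C` given by a dual basis. -/
abbrev comodule (he : IsDualBasis e) : RightComodule A C (LeftDual A C) where
  coact := dualCoact e
  coassoc := he.assoc_map_dualCoact
  counit := he.actMap_counit_dualCoact

variable {X : Type*} [AddCommGroup X] [Module Aᵐᵒᵖ X] [RightComodule A C X]

theorem comoduleHom_le_moritaQ (he : IsDualBasis e) :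
    let _ := he.comodule
    comoduleHom A C X (LeftDual A C) ≤ moritaQ A C X := fun q hq =>
  (mem_moritaQ_iff_dualHom_map_coact q).2 fun x => by
    rw [← hq x]
    exact he.dualHom_dualCoact (q x)

theorem toS_surjective (he : IsDualBasis e)
    (hX : let _ := he.comodule; Function.Surjective (tensorCounit A C X (LeftDual A C))) :
    Function.Surjective (moritaContext A C X).toS := by
  let _ := he.comodule
  intro f
  obtain ⟨z, rfl⟩ := hX f
  rw [← AddMonoidHom.mem_range]
  induction z using BalTensor.induction with
  | zero => rw [_root_.map_zero]; exact zero_mem _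
  | add z w hz hw => rw [_root_.map_add]; exact add_mem hz hw
  | tmul q x =>
    exact ⟨tmul (comodEnd A C X) (⟨q.1, he.comoduleHom_le_moritaQ q.2⟩ : moritaQ A C X) x, rfl⟩

end IsDualBasis

end DualComodule

section Equalizer

variable {A C : Type*} [Ring A] [AddCommGroup C] [Module A C] [Module Aᵐᵒᵖ C]
  [SMulCommClass A Aᵐᵒᵖ C] [Coring A C]
  {X : Type*} [AddCommGroup X] [Module Aᵐᵒᵖ X] [RightComodule A C X]
  {M : Type*} [AddCommGroup M] [Module Aᵐᵒᵖ M] [RightComodule A C M]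

variable (A C M) in
theorem coact_injective : Function.Injective (coact A C : M →ₗ[Aᵐᵒᵖ] BalTensor A M C) :=
  Function.LeftInverse.injective RightComodule.counit

variable (A C X M) in
/-- The inclusion `Hom^C(X, M) → Hom_A(X, M)`, as a map of right `T`-modules. -/
def comoduleHomIncl : comoduleHom A C X M →ₗ[(comodEnd A C X)ᵐᵒᵖ] (X →ₗ[Aᵐᵒᵖ] M) where
  __ := (comoduleHom A C X M).subtype
  map_smul' _ _ := rfl

variable (A C X M) in
/-- The map sending `φ ∈ Hom_A(X, M)` to `x ↦ φ(x)⁽⁰⁾ ⊗ φ(x)⁽¹⁾ - φ(x⁽⁰⁾) ⊗ x⁽¹⁾`, which vanishes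
exactly if `φ` is a comodule map. -/
def comoduleHomDefect :
    (X →ₗ[Aᵐᵒᵖ] M) →ₗ[(comodEnd A C X)ᵐᵒᵖ] (X →ₗ[Aᵐᵒᵖ] BalTensor A M C) where
  toFun φ := coact A C ∘ₗ φ - rTensor (S := A) C φ ∘ₗ coact A C
  map_add' φ ψ := LinearMap.ext fun x => by
    change coact A C (φ x + ψ x) - map (φ + ψ) LinearMap.id (coact A C x) =
      coact A C (φ x) - map φ LinearMap.id (coact A C x) +
        (coact A C (ψ x) - map ψ LinearMap.id (coact A C x))
    rw [_root_.map_add, map_add_left, add_sub_add_comm]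
  map_smul' t φ := LinearMap.ext fun x =>
    congrArg (coact A C (φ (t.unop.1 x)) - ·) <|
      (map_comp φ LinearMap.id t.unop.1 LinearMap.id (coact A C x)).trans
        (congrArg (map φ LinearMap.id) (t.unop.2 x).symm)

theorem exact_comoduleHomIncl_defect :
    Function.Exact (comoduleHomIncl A C X M) (comoduleHomDefect A C X M) := by
  refine fun φ => ⟨fun hφ => ?_, ?_⟩
  · exact ⟨⟨φ, fun x => sub_eq_zero.1 (LinearMap.congr_fun hφ x)⟩, rfl⟩
  · rintro ⟨φ, rfl⟩
    exact LinearMap.ext fun x => sub_eq_zero.2 (φ.2 x)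

theorem coact_tensorCounit (z : BalTensor (comodEnd A C X) (comoduleHom A C X M) X) :
    coact A C (tensorCounit A C X M z) =
      can A C X M (map (comoduleHomIncl A C X M) LinearMap.id z) := by
  induction z using BalTensor.induction with
  | zero => simp only [_root_.map_zero]
  | tmul φ x => exact φ.2 x
  | add x y hx hy => simp only [_root_.map_add, hx, hy]

theorem assoc_can_map_defect (z : BalTensor (comodEnd A C X) (X →ₗ[Aᵐᵒᵖ] M) X) :
    assoc (can A C X _ (map (comoduleHomDefect A C X M) LinearMap.id z)) =
      assoc (map (coact A C) LinearMap.id (can A C X M z)) -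
        map LinearMap.id (Coring.comulL A C) (can A C X M z) := by
  induction z using BalTensor.induction with
  | zero => simp only [_root_.map_zero, sub_zero]
  | add x y hx hy => simp only [_root_.map_add, hx, hy, add_sub_add_comm]
  | tmul φ x =>
    have map_comulL : map LinearMap.id (Coring.comulL A C) (map φ LinearMap.id (coact A C x)) =
        assoc (map (rTensor (S := A) C φ ∘ₗ coact A C) LinearMap.id (coact A C x)) := by
      calc map LinearMap.id (Coring.comulL A C) (map φ LinearMap.id (coact A C x))
          = map φ LinearMap.id (map LinearMap.id (Coring.comulL A C) (coact A C x)) := by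
            rw [← map_comp, ← map_comp]
            rfl
        _ = assoc (map (rTensor (S := A) C φ) LinearMap.id
              (map (coact A C) LinearMap.id (coact A C x))) := by
            rw [← RightComodule.coassoc, assoc_map_rTensor]
        _ = assoc (map (rTensor (S := A) C φ ∘ₗ coact A C) LinearMap.id (coact A C x)) := by
            rw [← map_comp, LinearMap.id_comp]
    change assoc (map (coact A C ∘ₗ φ - rTensor (S := A) C φ ∘ₗ coact A C) LinearMap.id
        (coact A C x)) = assoc (map (coact A C) LinearMap.id (map φ LinearMap.id (coact A C x))) -
      map LinearMap.id (Coring.comulL A C) (map φ LinearMap.id (coact A C x))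
    rw [map_comulL, map_sub_left, _root_.map_sub, ← map_comp, LinearMap.id_comp]

end Equalizer

section FaithfullyFlat

theorem IsFaithfullyFlat.injective_iff {R P N N' : Type u} [Ring R] [AddCommGroup P] [Module R P]
    [AddCommGroup N] [Module Rᵐᵒᵖ N] [AddCommGroup N'] [Module Rᵐᵒᵖ N']
    (h : IsFaithfullyFlat R P) (f : N →ₗ[Rᵐᵒᵖ] N') :
    Function.Injective (map f (LinearMap.id : P →ₗ[R] P)) ↔ Function.Injective f := by
  have zero_exact := h PUnit.{u + 1} N N' 0 f
  rw [LinearMap.exact_zero_iff_injective] at zero_exact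
  rw [zero_exact, injective_iff_map_eq_zero]
  refine forall_congr' fun z => ⟨fun hz => ⟨fun h0 => ⟨0, ?_⟩, ?_⟩, fun hz h0 => ?_⟩
  · rw [hz h0, _root_.map_zero]
  · rintro ⟨w, rfl⟩
    rw [map_zero_left, _root_.map_zero]
  · obtain ⟨w, rfl⟩ := hz.1 h0
    exact map_zero_left _ w

theorem IsFaithfullyFlat.surjective_of_map {R P N N' : Type u} [Ring R] [AddCommGroup P]
    [Module R P] [AddCommGroup N] [Module Rᵐᵒᵖ N] [AddCommGroup N'] [Module Rᵐᵒᵖ N']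
    (h : IsFaithfullyFlat R P) {f : N →ₗ[Rᵐᵒᵖ] N'}
    (hf : Function.Surjective (map f (LinearMap.id : P →ₗ[R] P))) : Function.Surjective f :=
  (LinearMap.exact_zero_iff_surjective PUnit.{u + 1} f).1 <|
    (h _ _ _ _ _).2 fun z => ⟨fun _ => hf z, fun _ => map_zero_left _ z⟩

variable {A C X : Type u} [Ring A] [AddCommGroup C] [Module A C] [Module Aᵐᵒᵖ C]
  [SMulCommClass A Aᵐᵒᵖ C] [Coring A C] [AddCommGroup X] [Module Aᵐᵒᵖ X] [RightComodule A C X]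

theorem IsGaloisComodule.tensorCounit_bijective (hX : IsGaloisComodule A C X)
    (hF : IsFaithfullyFlat (comodEnd A C X) X) (M : Type u) [AddCommGroup M] [Module Aᵐᵒᵖ M]
    [RightComodule A C M] : Function.Bijective (tensorCounit A C X M) := by
  constructor
  · have incl_injective : Function.Injective (comoduleHomIncl A C X M) := Subtype.val_injective
    refine Function.Injective.of_comp (f := coact A C) ?_
    simpa only [Function.comp_def, coact_tensorCounit] using
      (hX M).1.comp ((hF.injective_iff _).2 incl_injective)
  · intro m
    obtain ⟨z, hz⟩ := (hX M).2 (coact A C m)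
    have defect_eq_zero : map (comoduleHomDefect A C X M) LinearMap.id z = 0 := by
      refine (hX _).1 (assoc.injective ?_)
      rw [assoc_can_map_defect, hz, RightComodule.coassoc, sub_self, _root_.map_zero,
        _root_.map_zero]
    obtain ⟨w, rfl⟩ := ((hF _ _ _ _ _).1 exact_comoduleHomIncl_defect z).1 defect_eq_zero
    exact ⟨w, coact_injective A C M ((coact_tensorCounit w).trans hz)⟩

theorem IsFaithfullyFlat.tensorUnit_bijective (hF : IsFaithfullyFlat (comodEnd A C X) X)
    {N : Type u} [AddCommGroup N] [Module (comodEnd A C X)ᵐᵒᵖ N]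
    (hN : Function.Injective (tensorCounit A C X (BalTensor (comodEnd A C X) N X))) :
    Function.Bijective (tensorUnit A C X N) := by
  have leftInverse : Function.LeftInverse (tensorCounit A C X _)
      (map (tensorUnit A C X N) LinearMap.id) := tensorCounit_map_tensorUnit
  exact ⟨(hF.injective_iff _).1 leftInverse.injective,
    hF.surjective_of_map (leftInverse.rightInverse_of_injective hN).surjective⟩

end FaithfullyFlat

theorem toT_surjective_of_tensorUnit_injective {A C X : Type*} [Ring A] [AddCommGroup C]
    [Module A C] [Module Aᵐᵒᵖ C] [SMulCommClass A Aᵐᵒᵖ C] [Coring A C] [AddCommGroup X]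
    [Module Aᵐᵒᵖ X] [RightComodule A C X] (hS : Function.Surjective (moritaContext A C X).toS)
    (hN : Function.Injective
      (tensorUnit A C X (comodEnd A C X ⧸ (moritaContext A C X).rangeToT))) :
    Function.Surjective (moritaContext A C X).toT :=
  MoritaContext.toT_surjective_of_tmul_quotient hS fun _ hn =>
    hN (Subtype.ext (LinearMap.ext fun x => (hn x).trans (zero_tmul x).symm))

end CoringMorita

theorem mainTheorem8_general {A : Type u} [Ring A] {C : Type u} [AddCommGroup C] [Module A C]
    [Module Aᵐᵒᵖ C] [SMulCommClass A Aᵐᵒᵖ C] [Coring A C]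
    {X : Type u} [AddCommGroup X] [Module Aᵐᵒᵖ X] [RightComodule A C X] :
    List.TFAE
      [(moritaContext A C X).IsStrict,
        (Module.Finite A C ∧ Module.Projective A C) ∧
          IsGaloisComodule A C X ∧ Module.Finite Aᵐᵒᵖ X ∧ Module.Projective Aᵐᵒᵖ X ∧
          IsFaithfullyFlat (comodEnd A C X) X,
        (Module.Finite A C ∧ Module.Projective A C) ∧
          ∃ e : CategoryTheory.Equivalence (ModuleCat.{u} (comodEnd A C X)ᵐᵒᵖ) (ComodCat A C),
            e.functor = tensorFunctor A C X ∧ e.inverse = homFunctor A C X] := by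
  rw [exists_equivalence_iff, ← exists_isDualBasis_iff]
  tfae_have 1 → 2 := fun h =>
    have hX := finite_and_projective_of_toT_surjective h.2.2
    ⟨exists_isDualBasis_of_toS_surjective h.1.2, fun _ _ _ => can_bijective h.1.2, hX.1, hX.2,
      h.isFaithfullyFlat⟩
  tfae_have 2 → 3 := fun ⟨hC, hG, _, _, hF⟩ =>
    have counit_bijective := hG.tensorCounit_bijective hF
    ⟨hC, fun _ _ _ => hF.tensorUnit_bijective (counit_bijective _).1, counit_bijective⟩
  tfae_have 3 → 1 := by
    rintro ⟨⟨e, he⟩, unit_bijective, counit_bijective⟩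
    let _ := he.comodule
    have hS := he.toS_surjective (counit_bijective (LeftDual A C)).2
    exact MoritaContext.isStrict_of_surjective hS
      (toT_surjective_of_tensorUnit_injective hS (unit_bijective _).1)
  tfae_finish

theorem mainTheorem8 {A : Type u} [Ring A] {C : Type u} [AddCommGroup C] [Module A C]
    [Module Aᵐᵒᵖ C] [SMulCommClass A Aᵐᵒᵖ C] [Coring A C]
    [Module.Finite A C] [Module.Projective A C]
    {X : Type u} [AddCommGroup X] [Module Aᵐᵒᵖ X] [RightComodule A C X] :
    List.TFAE
      [(moritaContext A C X).IsStrict,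
        IsGaloisComodule A C X ∧ Module.Finite Aᵐᵒᵖ X ∧ Module.Projective Aᵐᵒᵖ X ∧
          IsFaithfullyFlat (comodEnd A C X) X,
        ∃ e : CategoryTheory.Equivalence (ModuleCat.{u} (comodEnd A C X)ᵐᵒᵖ) (ComodCat A C),
          e.functor = tensorFunctor A C X ∧ e.inverse = homFunctor A C X] := by
  have hC : Module.Finite A C ∧ Module.Projective A C := ⟨inferInstance, inferInstance⟩
  simpa only [and_iff_right hC] using mainTheorem8_general (A := A) (C := C) (X := X)
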